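/- **Theorem (Entropy estimate).** Let $G=\mathrm{SO}(3,1)$ be the group of real $4\times4$ matrices of determinant one that preserve the form $x_1^2+x_2^2+x_3^2-t^2$ and the direction of time, let $K=\mathrm{SO}(3)<G$ be the rotations of the space coordinates, and let $G$ act on the sphere of light rays $S^2$, with $m$ the rotation-invariant probability measure on $S^2$. Put $\mathcal N(g)=\left\|\frac{dg_*m}{dm}\right\|_\infty$ for $g\in G$. For a finite non-empty set $C=\{c_1,\dots,c_k\}\subset K$ let $$\kappa_C=1-\sup\Big\{\Big\|\tfrac1{2k}\sum_{i=1}^k\big(f\circ c_i+f\circ c_i^{-1}\big)\Big\|_{L^2(m)} : f\in L^2(S^2,m),\ \int f\,dm=0,\ \|f\|_{L^2(m)}=1\Big\}.$$ Let $\Gamma$ be a group generated by a finite set $A$, with word length $|\cdot|_A$, and let $B\subset\Gamma$ be a finite non-empty subset. Let $\mu$ be a probability measure on $\Gamma$ whose support generates $\Gamma$ as a semigroup (the identity counting as the empty product) and which has a finite exponential moment: $\sum_\gamma\mu(\gamma)e^{\epsilon|\gamma|_A}<\infty$ for some $\epsilon>0$. Let $\kappa_0>0$. For a homomorphism $\rho:\Gamma\to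 G$ put $\alpha_\rho=\max_{a\in A\cup A^{-1}}\log\mathcal N(\rho(a))$. A probability measure $\nu$ on $S^2$ is called stationary for $\rho$ if $\nu=\sum_\gamma\mu(\gamma)\,\rho(\gamma)_*\nu$. Then there are constants $c_{\rm ent}>0$, $L>0$ and $\alpha_0>0$, depending only on $\Gamma,\mu,A,B,\kappa_0$, such that for every homomorphism $\rho:\Gamma\to G$ with Zariski dense image, with $\rho(B)\subset K$, with spectral gap $\kappa_{\rho(B)}\ge\kappa_0$, and with $0<\alpha_\rho\le\alpha_0$, there is exactly one stationary probability measure $\nu_\rho$ on $S^2$, the function $(\gamma,x)\mapsto-\log\frac{d\rho(\gamma)^{-1}_*\nu_\rho}{d\nu_\rho}(x)$ is $\mu\times\nu_\rho$-integrable, and the Furstenberg entropy $$h_\mu(S^2,\nu_\rho)=\sum_{\gamma}\mu(\gamma)\int_{S^2}-\log\frac{d\rho(\gamma)^{-1}_*\nu_\rho}{d\nu_\rho}\,d\nu_\rho$$ satisfies $$c_{\rm ent}\,\alpha_\rho^2\ \le\ h_\mu(S^2,\nu_\rho)\ \le\ L\,\alpha_\rho .$$ -/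

import Mathlib

open MeasureTheory
open scoped Pointwise ENNReal

noncomputable section

namespace SpectralGapEntropy

/-! ### The group `SO(3,1)` and its action on the two-sphere -/

/-- Matrices acting on `ℝ³ ⊕ ℝ`: three space coordinates `Sum.inl i`, one time coordinate
`Sum.inr ()`. -/
abbrev Mat : Type := Matrix (Fin 3 ⊕ Unit) (Fin 3 ⊕ Unit) ℝ

/-- The Gram matrix `diag(1, 1, 1, -1)` of the Lorentz form. -/
abbrev J : Mat := LieAlgebra.Orthogonal.indefiniteDiagonal (Fin 3) Unit ℝ

/-- The light cone form `x₁² + x₂² + x₃² - t²`. -/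
def lorentz (v : Fin 3 ⊕ Unit → ℝ) : ℝ :=
  ∑ i : Fin 3, v (Sum.inl i) ^ 2 - v (Sum.inr ()) ^ 2

theorem J_mul_J : J * J = 1 := by
  ext i j
  rcases i with i | i <;> rcases j with j | j <;>
    simp [J, LieAlgebra.Orthogonal.indefiniteDiagonal, Matrix.diagonal_apply, Matrix.one_apply]

theorem lorentz_eq (v : Fin 3 ⊕ Unit → ℝ) : lorentz v = v ⬝ᵥ (J.mulVec v) := by
  simp [lorentz, J, LieAlgebra.Orthogonal.indefiniteDiagonal, dotProduct, Matrix.mulVec_diagonal,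
    Fin.sum_univ_three]
  ring

theorem lorentz_mulVec {g : Mat} (hg : g.transpose * J * g = J) (v : Fin 3 ⊕ Unit → ℝ) :
    lorentz (g.mulVec v) = lorentz v := by
  rw [lorentz_eq, lorentz_eq]
  nth_rewrite 2 [← hg]
  rw [← Matrix.mulVec_mulVec, ← Matrix.mulVec_mulVec, Matrix.dotProduct_mulVec v,
    Matrix.vecMul_transpose]

theorem inv_formula {g : Mat} (hg : g.transpose * J * g = J) :
    g * (J * g.transpose * J) = 1 := by
  rw [mul_eq_one_comm]
  calc J * g.transpose * J * g = J * (g.transpose * J * g) := by simp only [Matrix.mul_assoc]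
    _ = 1 := by rw [hg, J_mul_J]

theorem transpose_mem {g : Mat} (hg : g.transpose * J * g = J) :
    g * J * g.transpose = J := by
  have h := inv_formula hg
  calc g * J * g.transpose = g * (J * g.transpose * J) * J := by
        simp only [Matrix.mul_assoc, J_mul_J, Matrix.mul_one]
    _ = J := by rw [h, Matrix.one_mul]

theorem time_pos {g : Mat} (hg : g.transpose * J * g = J)
    (h0 : 0 < g (Sum.inr ()) (Sum.inr ())) {v : Fin 3 ⊕ Unit → ℝ} (hv : lorentz v ≤ 0)
    (hv0 : 0 < v (Sum.inr ())) : 0 < g.mulVec v (Sum.inr ()) := by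
  have h1 := congrFun (congrFun (transpose_mem hg) (Sum.inr ())) (Sum.inr ())
  simp [J, LieAlgebra.Orthogonal.indefiniteDiagonal, Matrix.mul_apply,
    Fin.sum_univ_three, Matrix.diagonal_apply] at h1
  simp only [lorentz, Fin.sum_univ_three] at hv
  simp only [Matrix.mulVec, dotProduct, Fintype.sum_sum_type, Fin.sum_univ_three,
    Finset.univ_unique, Finset.sum_singleton]
  change 0 < _ + g (Sum.inr ()) (Sum.inr ()) * v (Sum.inr ())
  generalize g (Sum.inr ()) (Sum.inr ()) = T at *
  generalize g (Sum.inr ()) (Sum.inl 0) = a at *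
  generalize g (Sum.inr ()) (Sum.inl 1) = b at *
  generalize g (Sum.inr ()) (Sum.inl 2) = c at *
  generalize v (Sum.inr ()) = t at *
  generalize v (Sum.inl 0) = x at *
  generalize v (Sum.inl 1) = y at *
  generalize v (Sum.inl 2) = z at *
  have hcs : (a * x + b * y + c * z) ^ 2 ≤ (a ^ 2 + b ^ 2 + c ^ 2) * (x ^ 2 + y ^ 2 + z ^ 2) := by
    nlinarith [sq_nonneg (a * y - b * x), sq_nonneg (a * z - c * x), sq_nonneg (b * z - c * y)]
  have hle : (a ^ 2 + b ^ 2 + c ^ 2) * (x ^ 2 + y ^ 2 + z ^ 2) ≤ (a ^ 2 + b ^ 2 + c ^ 2) * t ^ 2 :=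
    mul_le_mul_of_nonneg_left (by linarith) (by positivity)
  have heq : a ^ 2 + b ^ 2 + c ^ 2 = T ^ 2 - 1 := by nlinarith
  have hlt : (a * x + b * y + c * z) ^ 2 < (T * t) ^ 2 := by
    rw [heq] at hle hcs
    nlinarith [pow_pos hv0 2]
  have := abs_lt_of_sq_lt_sq hlt (by positivity)
  linarith [(abs_lt.mp this).1]

/-- The (connected) group `SO(3,1)`: real matrices of determinant one which preserve the Lorentz
form and the direction of time. -/
def SO31 : Subgroup (Matrix.SpecialLinearGroup (Fin 3 ⊕ Unit) ℝ) where
  carrier := {g | (g : Mat).transpose * J * (g : Mat) = J ∧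
    0 < (g : Mat) (Sum.inr ()) (Sum.inr ())}
  one_mem' := by simp
  mul_mem' := by
    rintro g h ⟨hg, hg0⟩ ⟨hh, hh0⟩
    refine ⟨?_, ?_⟩
    · rw [Matrix.SpecialLinearGroup.coe_mul, Matrix.transpose_mul]
      calc (h : Mat).transpose * (g : Mat).transpose * J * ((g : Mat) * (h : Mat))
          = (h : Mat).transpose * ((g : Mat).transpose * J * (g : Mat)) * (h : Mat) := by
            simp only [Matrix.mul_assoc]
        _ = J := by rw [hg, hh]
    · have hcol : (h : Mat).mulVec (Pi.single (Sum.inr ()) 1) (Sum.inr ())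
          = (h : Mat) (Sum.inr ()) (Sum.inr ()) := by simp
      have hl : lorentz ((h : Mat).mulVec (Pi.single (Sum.inr ()) 1)) ≤ 0 := by
        rw [lorentz_mulVec hh]; simp [lorentz]
      have := time_pos hg hg0 hl (by rw [hcol]; exact hh0)
      rw [Matrix.mulVec_mulVec] at this
      simpa using this
  inv_mem' := by
    rintro g ⟨hg, hg0⟩
    have h1 : ((g⁻¹ : Matrix.SpecialLinearGroup (Fin 3 ⊕ Unit) ℝ) : Mat) * (g : Mat) = 1 := by
      rw [← Matrix.SpecialLinearGroup.coe_mul, inv_mul_cancel, Matrix.SpecialLinearGroup.coe_one]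
    have hinv : ((g⁻¹ : Matrix.SpecialLinearGroup (Fin 3 ⊕ Unit) ℝ) : Mat)
        = J * (g : Mat).transpose * J :=
      left_inv_eq_right_inv h1 (inv_formula hg)
    refine ⟨?_, ?_⟩
    · rw [hinv]
      have ht : J.transpose = J := by
        simp [J, LieAlgebra.Orthogonal.indefiniteDiagonal]
      simp only [Matrix.transpose_mul, ht, Matrix.transpose_transpose]
      calc J * ((g : Mat) * J) * J * (J * (g : Mat).transpose * J)
          = J * ((g : Mat) * (J * (J * J)) * (g : Mat).transpose) * J := by
            simp only [Matrix.mul_assoc]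
        _ = J * ((g : Mat) * J * (g : Mat).transpose) * J := by rw [J_mul_J, Matrix.mul_one]
        _ = J := by rw [transpose_mem hg, J_mul_J, Matrix.one_mul]
    · rw [hinv]
      simpa [J, LieAlgebra.Orthogonal.indefiniteDiagonal, Matrix.mul_apply,
        Matrix.diagonal_apply] using hg0

/-- The matrix of an element of `SO(3,1)`. -/
def toMat (g : SO31) : Mat := ((g : Matrix.SpecialLinearGroup (Fin 3 ⊕ Unit) ℝ) : Mat)

/-- The maximal compact subgroup `K = SO(3)`, embedded as the rotations of the space
coordinates. -/
def K : Set SO31 :=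
  {g | ∃ R ∈ Matrix.specialOrthogonalGroup (Fin 3) ℝ, toMat g = Matrix.fromBlocks R 0 0 1}

/-- The unit sphere `S²` of Euclidean three-space. -/
abbrev S2 : Type := Metric.sphere (0 : EuclideanSpace ℝ (Fin 3)) 1

/-- The future-pointing light-like vector `(x, 1)` above a point `x` of the sphere. -/
def lightVec (x : S2) : Fin 3 ⊕ Unit → ℝ := Sum.elim (fun i => x.1 i) (fun _ => 1)

theorem lorentz_lightVec (x : S2) : lorentz (lightVec x) = 0 := by
  have h : ‖x.1‖ = 1 := norm_eq_of_mem_sphere x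
  have h2 := EuclideanSpace.real_norm_sq_eq x.1
  simp [lorentz, lightVec, ← h2, h]

theorem act_time_pos (g : SO31) (x : S2) : 0 < (toMat g).mulVec (lightVec x) (Sum.inr ()) :=
  time_pos g.2.1 g.2.2 (lorentz_lightVec x).le (by simp [lightVec])

/-- The action of `SO(3,1)` on the sphere of light rays: if `g (x, 1) = (y, t)` then
`g x = y / t`. -/
def act (g : SO31) (x : S2) : S2 :=
  ⟨WithLp.toLp 2 fun i => (toMat g).mulVec (lightVec x) (Sum.inl i) /
      (toMat g).mulVec (lightVec x) (Sum.inr ()), by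
    have ht := act_time_pos g x
    have h := lorentz_mulVec g.2.1 (lightVec x)
    rw [lorentz_lightVec] at h
    change lorentz ((toMat g).mulVec (lightVec x)) = 0 at h
    rw [mem_sphere_zero_iff_norm, ← sq_eq_sq₀ (norm_nonneg _) zero_le_one,
      EuclideanSpace.real_norm_sq_eq]
    simp only [lorentz, Fin.sum_univ_three] at h
    simp only [Fin.sum_univ_three]
    field_simp
    linarith⟩

instance : SMul SO31 S2 := ⟨act⟩

theorem lightVec_smul (g : SO31) (x : S2) :
    lightVec (g • x) =
      ((toMat g).mulVec (lightVec x) (Sum.inr ()))⁻¹ • (toMat g).mulVec (lightVec x) := by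
  have ht := act_time_pos g x
  funext i
  rcases i with i | i
  · change (toMat g).mulVec (lightVec x) (Sum.inl i) / _ = _
    simp [div_eq_inv_mul]
  · change (1 : ℝ) = _ * _
    rw [inv_mul_cancel₀ ht.ne']

theorem lightVec_injective : Function.Injective lightVec := by
  intro x y h
  apply Subtype.ext
  ext i
  exact congrFun h (Sum.inl i)

instance : MulAction SO31 S2 where
  one_smul x := by
    apply lightVec_injective
    rw [lightVec_smul]
    simp [toMat, lightVec]
  mul_smul g h x := by
    apply lightVec_injective
    have hh := act_time_pos h x
    have hgh : (toMat (g * h)).mulVec (lightVec x)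
        = (toMat g).mulVec ((toMat h).mulVec (lightVec x)) := by
      simp [toMat, Matrix.mulVec_mulVec]
    rw [lightVec_smul, lightVec_smul g, lightVec_smul h, hgh, Matrix.mulVec_smul]
    funext i
    simp only [Pi.smul_apply, smul_eq_mul]
    field_simp

/-- The rotation-invariant probability measure on the sphere: normalized surface area. -/
def m : Measure S2 :=
  ((volume : Measure (EuclideanSpace ℝ (Fin 3))).toSphere Set.univ)⁻¹ •
    (volume : Measure (EuclideanSpace ℝ (Fin 3))).toSphere

/-- The norm `𝒩(g) = ‖d(g_* m)/dm‖_∞` on `SO(3,1)`. -/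
def normRN (g : SO31) : ℝ :=
  (essSup ((m.map fun x => g • x).rnDeriv m) m).toReal

/-- The spectral gap of a finite set `C = {c₁, …, c_k}` of rotations,
`1 - sup ‖(1/2k) ∑ (f ∘ cᵢ + f ∘ cᵢ⁻¹)‖₂` over the unit vectors `f` in `L²₀(S², m)`. -/
def kappa (C : Finset SO31) : ℝ :=
  1 - sSup {r : ℝ | ∃ f : S2 → ℝ, MemLp f 2 m ∧ ∫ x, f x ∂m = 0 ∧ eLpNorm f 2 m = 1 ∧
    r = (eLpNorm (fun x => (2 * (C.card : ℝ))⁻¹ * ∑ c ∈ C, (f (c • x) + f (c⁻¹ • x))) 2 m).toReal}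

/-! ### The group `Γ`, the measure `μ` and representations -/

section Representations

variable {Γ : Type*} [Group Γ]

/-- The word length of `γ` with respect to `A`. -/
def wordLength (A : Finset Γ) (γ : Γ) : ℕ :=
  sInf {n : ℕ | γ ∈ ((A : Set Γ) ∪ (A : Set Γ)⁻¹) ^ n}

/-- `μ` has a finite exponential moment. -/
def HasFiniteExpMoment (A : Finset Γ) (μ : PMF Γ) : Prop :=
  ∃ ε : ℝ, 0 < ε ∧ Summable fun γ => (μ γ).toReal * Real.exp (ε * wordLength A γ)

/-- `μ` generates `Γ` as a semigroup (the identity counting as the empty product). -/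
def GeneratesAsSemigroup (μ : PMF Γ) : Prop := Submonoid.closure μ.support = ⊤

/-- The image of `ρ` is Zariski dense in `SO(3,1)`: a real polynomial in the matrix entries which
vanishes on the image vanishes on the whole group. -/
def ZariskiDense (ρ : Γ →* SO31) : Prop :=
  ∀ P : MvPolynomial ((Fin 3 ⊕ Unit) × (Fin 3 ⊕ Unit)) ℝ,
    (∀ γ, MvPolynomial.eval (fun ij => toMat (ρ γ) ij.1 ij.2) P = 0) →
      ∀ g : SO31, MvPolynomial.eval (fun ij => toMat g ij.1 ij.2) P = 0

/-- `α_ρ`, the maximum of `log 𝒩(ρ(a))` over `a ∈ A ∪ A⁻¹`. -/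
def alpha (A : Finset Γ) (ρ : Γ →* SO31) : ℝ :=
  sSup ((fun a => Real.log (normRN (ρ a))) '' ((A : Set Γ) ∪ (A : Set Γ)⁻¹))

open scoped Classical in
/-- The spectral gap of the finite set `ρ(B)`. -/
def repGap (B : Finset Γ) (ρ : Γ →* SO31) : ℝ := kappa (B.image ρ)

/-- `ν` is a `μ`-stationary probability measure for the action of `Γ` on the sphere
through `ρ`. -/
def IsStationary (μ : PMF Γ) (ρ : Γ →* SO31) (ν : Measure S2) : Prop :=
  IsProbabilityMeasure ν ∧ Measure.sum (fun γ => μ γ • ν.map fun x => ρ γ • x) = ν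

/-- The cocycle `-log (d(γ⁻¹_* ν)/dν)`. -/
def cocycle (ρ : Γ →* SO31) (ν : Measure S2) (γ : Γ) (x : S2) : ℝ :=
  -Real.log ((ν.map fun y => (ρ γ)⁻¹ • y).rnDeriv ν x).toReal

/-- The cocycle is integrable for the product of `μ` and `ν`. -/
def EntropyIntegrable (μ : PMF Γ) (ρ : Γ →* SO31) (ν : Measure S2) : Prop :=
  (∀ γ ∈ μ.support, Integrable (cocycle ρ ν γ) ν) ∧
    Summable fun γ => (μ γ).toReal * ∫ x, |cocycle ρ ν γ x| ∂ν

/-- The Furstenberg entropy `h_μ(S², ν) = ∫_Γ ∫_{S²} -log (d(γ⁻¹_* ν)/dν) dν dμ`. -/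
def entropy (μ : PMF Γ) (ρ : Γ →* SO31) (ν : Measure S2) : ℝ :=
  ∑' γ, (μ γ).toReal * ∫ x, cocycle ρ ν γ x ∂ν

end Representations

end SpectralGapEntropy

end

/-!
For `g` in `SO(3,1)` let `t_g(x)` be the time coordinate of `g (x, 1)`. The map `g` is conformal on
the sphere, `|g x - g y|² t_g(x) t_g(y) = |x - y|²` (`dist_smul_sq`), and `g⁻¹_* m` has the density
`t_g⁻²` with respect to `m` (`lintegral_smul_m`), by a change of variables on the light cone. Hence
`log 𝒩(g)` is twice the maximum of the logarithm of a conformal factor, and `t_{ρ(γ)}` and its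
inverse are at most `exp (α_ρ |γ| / 2)`. By the exponential moment, the Markov operator
`T f = ∑ μ(γ) f ∘ ρ(γ)` has a norm close to `1` on `L²(m)` when `α_ρ` is small, and it multiplies
Lipschitz constants by at most a number close to `1`.

*Contraction.* Each `b ∈ B` is a product of elements of the support of `μ`, and so a power of `T`
contains a fixed multiple of `f ↦ f ∘ ρ(b)` (`exists_pow_sub_smul_le`). By the spectral gap of
`ρ(B)`, an average `Q` of powers of `T`, with exponents which do not depend on `ρ`, contracts the
functions of mean zero in `L²(m)` as soon as `α_ρ` is small (`exists_contraction`).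

*Existence and uniqueness.* Since `T` commutes with `Q`, its adjoint has a fixed vector
(`exists_adjoint_fixed`); it is non-negative, and is the density `φ ∈ L²(m)` of a stationary measure
(`exists_stationary_density`). There is no other stationary measure, singular ones included: for a
Lipschitz function `f`, the functions `Q^k f`, minus their means, decay in `L²(m)` faster than their
Lipschitz constants can grow. A Lipschitz function which is small in `L²(m)` is small uniformly
(`exists_lipschitz_bound`), so the integral of `f` against a stationary measure is the limit of the
means of `Q^k f` (`stationary_unique`).

*Upper bound.* The cocycle is `log φ - log (φ ∘ ρ(γ)) + 2 log t_{ρ(γ)}` (`cocycle_ae`). As `log φ`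
is integrable, its contributions cancel by stationarity, and the entropy is the mean of
`∫ 2 log t_{ρ(γ)} dν` (`hasSum_entropy`), which is at most `α_ρ ∑ μ(γ) |γ|` (`entropy_le`).

*Lower bound.* Let `ψ = √φ`, a unit vector of `L²(m)`, and let `U_g f = t_g⁻¹ (f ∘ g)` be the
unitary Koopman operator. The integral of the cocycle of `γ` is at least the squared Hellinger
distance `‖U_γ ψ - ψ‖²` (`norm_unitaryKoopman_sub_sq_le`). Hence each element of `Γ` moves `ψ` by
`O(√h)`, where `h` is the entropy. For the elements of `B`, which act by rotations, the spectral gap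
shows that `ψ` is within `O(√h)` of a constant, and so each generator `a` moves the constants by
`O(√h)`. For a generator with `log 𝒩(ρ(a)) = α_ρ` the function `t_{ρ(a)}⁻¹ - 1` has an `L²` norm of
order `α_ρ` (`exists_le_norm_halfDensity_sub_one`), and `α_ρ = O(√h)` follows
(`exists_alpha_le_sqrt_entropy`).
-/

noncomputable section

namespace SpectralGapEntropy

/-! ### The conformal factor of a Lorentz transformation -/

/-- The time coordinate of `g (x, 1)`. The conformal factor of the action of `g` at `x` is its
inverse. -/
def timeFactor (g : SO31) (x : S2) : ℝ := (toMat g).mulVec (lightVec x) (Sum.inr ())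

theorem timeFactor_pos (g : SO31) (x : S2) : 0 < timeFactor g x := act_time_pos g x

theorem toMat_mul (g h : SO31) : toMat (g * h) = toMat g * toMat h := by simp [toMat]

theorem mulVec_lightVec (g : SO31) (x : S2) :
    (toMat g).mulVec (lightVec x) = timeFactor g x • lightVec (g • x) := by
  rw [lightVec_smul, smul_smul]
  change _ = (timeFactor g x * (timeFactor g x)⁻¹) • _
  rw [mul_inv_cancel₀ (timeFactor_pos g x).ne', one_smul]

theorem timeFactor_mul (g h : SO31) (x : S2) :
    timeFactor (g * h) x = timeFactor g (h • x) * timeFactor h x := by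
  simp only [timeFactor]
  rw [toMat_mul, ← Matrix.mulVec_mulVec, mulVec_lightVec h x, Matrix.mulVec_smul]
  have h1 : lightVec (h • x) (Sum.inr ()) = 1 := rfl
  simp only [timeFactor, Pi.smul_apply, smul_eq_mul, h1]
  ring

theorem timeFactor_one (x : S2) : timeFactor 1 x = 1 := by
  simp [timeFactor, toMat, lightVec]

theorem timeFactor_inv (g : SO31) (x : S2) :
    timeFactor g⁻¹ x = (timeFactor g (g⁻¹ • x))⁻¹ := by
  have h := timeFactor_mul g g⁻¹ x
  rw [mul_inv_cancel, timeFactor_one] at h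
  exact eq_inv_of_mul_eq_one_right h.symm

theorem continuous_lightVec : Continuous lightVec := by
  refine continuous_pi fun i => ?_
  rcases i with i | i
  · change Continuous fun x : S2 => x.1 i
    fun_prop
  · exact continuous_const

theorem continuous_mulVec_lightVec (g : SO31) (i : Fin 3 ⊕ Unit) :
    Continuous fun x => (toMat g).mulVec (lightVec x) i := by
  have := continuous_lightVec
  exact (continuous_apply i).comp (Continuous.matrix_mulVec continuous_const this)

theorem continuous_timeFactor (g : SO31) : Continuous (timeFactor g) :=
  continuous_mulVec_lightVec g _

theorem smul_val_apply (g : SO31) (x : S2) (i : Fin 3) :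
    (g • x).1 i = (toMat g).mulVec (lightVec x) (Sum.inl i) / timeFactor g x := rfl

theorem continuous_smul_S2 (g : SO31) : Continuous fun x : S2 => g • x := by
  refine Continuous.subtype_mk ((PiLp.continuous_toLp 2 _).comp (continuous_pi fun i => ?_)) _
  exact (continuous_mulVec_lightVec g _).div (continuous_timeFactor g)
    fun x => (timeFactor_pos g x).ne'

theorem measurable_smul_S2 (g : SO31) : Measurable fun x : S2 => g • x :=
  (continuous_smul_S2 g).measurable

theorem lorentz_lightVec_sub (x y : S2) : lorentz (lightVec x - lightVec y) = dist x y ^ 2 := by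
  rw [Subtype.dist_eq, EuclideanSpace.dist_eq, Real.sq_sqrt (by positivity)]
  simp [lorentz, lightVec, Real.dist_eq, sq_abs]

/-- Conformality of the action: the Lorentz form of the difference of the light-like vectors above
two points is the square of their distance, and `g` preserves the form. -/
theorem dist_smul_sq (g : SO31) (x y : S2) :
    timeFactor g x * timeFactor g y * dist (g • x) (g • y) ^ 2 = dist x y ^ 2 := by
  have hg : lorentz ((toMat g).mulVec (lightVec x - lightVec y))
      = lorentz (lightVec x - lightVec y) := lorentz_mulVec g.2.1 _
  rw [← lorentz_lightVec_sub, ← lorentz_lightVec_sub x, ← hg, Matrix.mulVec_sub, mulVec_lightVec,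
    mulVec_lightVec]
  have h1 := lorentz_lightVec (g • x)
  have h2 := lorentz_lightVec (g • y)
  clear hg
  simp only [lorentz, Fin.sum_univ_three, Pi.sub_apply, Pi.smul_apply, smul_eq_mul] at h1 h2 ⊢
  generalize lightVec (g • x) = X at *
  generalize lightVec (g • y) = Y at *
  generalize timeFactor g x = a at *
  generalize timeFactor g y = b at *
  linear_combination (a * b - a ^ 2) * h1 + (a * b - b ^ 2) * h2

theorem dist_smul_le {g : SO31} {C : ℝ} (hC : ∀ x, (timeFactor g x)⁻¹ ≤ C) (x y : S2) :
    dist (g • x) (g • y) ≤ C * dist x y := by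
  have hx := timeFactor_pos g x
  have hy := timeFactor_pos g y
  have hC0 : 0 ≤ C := (inv_pos.2 hx).le.trans (hC x)
  refine (sq_le_sq₀ dist_nonneg (by positivity)).1 ?_
  have h := dist_smul_sq g x y
  have h3 : dist (g • x) (g • y) ^ 2
      = (timeFactor g x)⁻¹ * (timeFactor g y)⁻¹ * dist x y ^ 2 := by
    rw [← h]; field_simp
  rw [h3, mul_pow, sq C]
  gcongr
  exacts [hC x, hC y]

theorem timeFactor_eq_one_of_mem_K {g : SO31} (hg : g ∈ K) (x : S2) : timeFactor g x = 1 := by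
  obtain ⟨R, -, h⟩ := hg
  simp [timeFactor, h, lightVec, Matrix.mulVec, dotProduct, Matrix.fromBlocks]

theorem timeFactor_inv_eq_one_of_mem_K {g : SO31} (hg : g ∈ K) (x : S2) :
    timeFactor g⁻¹ x = 1 := by
  rw [timeFactor_inv, timeFactor_eq_one_of_mem_K hg, inv_one]

/-- The affine form defining the time factor is Lipschitz, with a constant controlled by its
oscillation between antipodal points. -/
theorem abs_timeFactor_sub_le {g : SO31} {C : ℝ}
    (hC : ∀ x, |timeFactor g x - timeFactor g (-x)| ≤ 2 * C) (x y : S2) :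
    |timeFactor g x - timeFactor g y| ≤ C * dist x y := by
  rcases eq_or_ne x y with rfl | hxy
  · simp
  have hd : 0 < dist x y := dist_pos.2 hxy
  have hd' : ‖x.1 - y.1‖ = dist x y := by rw [Subtype.dist_eq, dist_eq_norm]
  let w : S2 := ⟨(dist x y)⁻¹ • (x.1 - y.1), by
    rw [mem_sphere_zero_iff_norm, norm_smul, hd', Real.norm_of_nonneg (by positivity)]
    field_simp⟩
  have hw := hC w
  have e : timeFactor g x - timeFactor g y
      = dist x y * ((timeFactor g w - timeFactor g (-w)) / 2) := by
    simp only [timeFactor, lightVec, Matrix.mulVec, dotProduct, Fintype.sum_sum_type,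
      Fin.sum_univ_three, Sum.elim_inl, Sum.elim_inr, w]
    simp
    field_simp
    ring
  rw [e, abs_mul, abs_of_pos hd, abs_div, abs_two, mul_comm]
  gcongr
  linarith

/-! ### Change of variables on the sphere -/

/-- The point `(y, ‖y‖)` of the light cone above a vector `y` of `ℝ³`. -/
def coneVec (y : EuclideanSpace ℝ (Fin 3)) : Fin 3 ⊕ Unit → ℝ :=
  Sum.elim (fun i => y i) fun _ => ‖y‖

/-- The map `y ↦ A y + ‖y‖ b` which `g`, with space rows `(A b)`, induces on the light cone,
parametrized by `y ↦ (y, ‖y‖)`. -/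
def coneMap (g : SO31) (y : EuclideanSpace ℝ (Fin 3)) : EuclideanSpace ℝ (Fin 3) :=
  WithLp.toLp 2 fun i => (toMat g).mulVec (coneVec y) (Sum.inl i)

theorem coneVec_smul (x : S2) {r : ℝ} (hr : 0 ≤ r) : coneVec (r • x.1) = r • lightVec x := by
  have h : ‖x.1‖ = 1 := norm_eq_of_mem_sphere x
  funext i
  rcases i with i | i
  · simp [coneVec, lightVec]
  · simp [coneVec, lightVec, norm_smul, h, abs_of_nonneg hr]

theorem coneMap_smul (g : SO31) (x : S2) {r : ℝ} (hr : 0 ≤ r) :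
    coneMap g (r • x.1) = (r * timeFactor g x) • (g • x).1 := by
  ext i
  simp only [coneMap, coneVec_smul x hr, Matrix.mulVec_smul, PiLp.smul_apply, Pi.smul_apply,
    smul_eq_mul, smul_val_apply]
  field_simp [(timeFactor_pos g x).ne']

/-- The direction of a non-zero vector. -/
def dir (y : EuclideanSpace ℝ (Fin 3)) (hy : y ≠ 0) : S2 :=
  ⟨‖y‖⁻¹ • y, by rw [mem_sphere_zero_iff_norm, norm_smul]; simp [hy]⟩

theorem norm_smul_dir (y : EuclideanSpace ℝ (Fin 3)) (hy : y ≠ 0) : ‖y‖ • (dir y hy).1 = y := by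
  simp [dir, hy]

theorem coneMap_coneMap (g h : SO31) (y : EuclideanSpace ℝ (Fin 3)) :
    coneMap g (coneMap h y) = coneMap (g * h) y := by
  rcases eq_or_ne y 0 with rfl | hy
  · have h0 : coneVec 0 = 0 := by
      funext i; rcases i with i | i <;> simp [coneVec]
    have h1 : ∀ g : SO31, coneMap g 0 = 0 := fun g => by
      ext i; simp [coneMap, h0]
    simp [h1]
  · rw [← norm_smul_dir y hy, coneMap_smul _ _ (norm_nonneg _), coneMap_smul _ _ (norm_nonneg _),
      coneMap_smul _ _ (mul_nonneg (norm_nonneg _) (timeFactor_pos _ _).le), timeFactor_mul,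
      smul_smul]
    congr 1
    ring

theorem coneMap_one (y : EuclideanSpace ℝ (Fin 3)) : coneMap 1 y = y := by
  ext i
  simp [coneMap, toMat, coneVec]

theorem coneMap_injective (g : SO31) : Function.Injective (coneMap g) := by
  intro x y h
  have := congrArg (coneMap g⁻¹) h
  simpa [coneMap_coneMap, coneMap_one] using this

theorem coneMap_surjective (g : SO31) : Function.Surjective (coneMap g) := fun y =>
  ⟨coneMap g⁻¹ y, by simp [coneMap_coneMap, coneMap_one]⟩

/-- The matrix `A + b xᵀ` of the derivative of `coneMap g` at a point of direction `x`. -/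
def coneDeriv (g : SO31) (x : S2) : Matrix (Fin 3) (Fin 3) ℝ :=
  (toMat g).toBlocks₁₁ + Matrix.of fun i j => toMat g (Sum.inl i) (Sum.inr ()) * x.1 j

/-- By Cramer's rule: the product `X` of `g` and the unipotent matrix with bottom row `(x, 1)` has
determinant one and upper left block `A + b xᵀ`, so that the determinant of this block is the lower
right entry of `X⁻¹`, which is `t_g(x)`. -/
theorem det_coneDeriv (g : SO31) (x : S2) : (coneDeriv g x).det = timeFactor g x := by
  have hinv := inv_formula g.2.1
  change toMat g * (J * (toMat g).transpose * J) = 1 at hinv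
  have hdet : (toMat g).det = 1 := g.1.2
  have e1 : ∀ i, (toMat g * (J * (toMat g).transpose * J)) i (Sum.inr ())
      = (1 : Mat) i (Sum.inr ()) := fun i => by rw [hinv]
  have h1 := e1 (Sum.inr ())
  have h2 : ∀ i : Fin 3, _ := fun i => e1 (Sum.inl i)
  simp [J, LieAlgebra.Orthogonal.indefiniteDiagonal, Matrix.mul_apply,
    Fin.sum_univ_three, Matrix.diagonal_apply] at h1 h2
  set c : Matrix Unit (Fin 3) ℝ := Matrix.of fun _ j => x.1 j with hc
  set X : Mat := toMat g * Matrix.fromBlocks 1 0 c 1 with hX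
  have hXdet : X.det = 1 := by
    rw [hX, Matrix.det_mul, hdet, Matrix.det_fromBlocks_zero₁₂]; simp
  set Y : Mat := Matrix.fromBlocks 1 (Matrix.of fun i _ => - toMat g (Sum.inr ()) (Sum.inl i)) 0
    (Matrix.of fun _ _ => timeFactor g x) with hY
  have hYdet : Y.det = timeFactor g x := by
    rw [hY, Matrix.det_fromBlocks_zero₂₁]; simp
  have hXY : X * Y = Matrix.fromBlocks (coneDeriv g x) 0
      (X.toBlocks₂₁) 1 := by
    have ht : timeFactor g x = toMat g (Sum.inr ()) (Sum.inl 0) * x.1 0 +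
      toMat g (Sum.inr ()) (Sum.inl 1) * x.1 1 + toMat g (Sum.inr ()) (Sum.inl 2) * x.1 2 +
      toMat g (Sum.inr ()) (Sum.inr ()) := by
      simp [timeFactor, lightVec, Matrix.mulVec, dotProduct, Fin.sum_univ_three]
    ext i j
    rcases i with i | i <;> rcases j with j | j
    · simp [hX, hY, Matrix.mul_apply, coneDeriv, hc, Matrix.toBlocks₁₁, Matrix.one_apply]
    · simp [hX, hY, Matrix.mul_apply, hc, Matrix.one_apply,
        Fin.sum_univ_three, ht]
      linear_combination h2 i
    · simp [hX, hY, Matrix.mul_apply, hc, Matrix.toBlocks₂₁, Matrix.one_apply]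
    · simp [hX, hY, Matrix.mul_apply, hc, Matrix.one_apply,
        Fin.sum_univ_three, ht]
      linear_combination h1
  have := congrArg Matrix.det hXY
  rw [Matrix.det_mul, hXdet, hYdet, Matrix.det_fromBlocks_zero₁₂] at this
  simpa using this.symm

theorem hasFDerivAt_coneMap (g : SO31) (y : EuclideanSpace ℝ (Fin 3)) (hy : y ≠ 0) :
    HasFDerivAt (coneMap g)
      (LinearMap.toContinuousLinearMap (Matrix.toEuclideanLin (coneDeriv g (dir y hy)))) y := by
  have hn : HasFDerivAt (fun z : EuclideanSpace ℝ (Fin 3) => ‖z‖) (‖y‖⁻¹ • innerSL ℝ y) y := by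
    have h := (hasStrictFDerivAt_norm_sq y).hasFDerivAt.sqrt (by simpa using hy)
    simp only [Real.sqrt_sq (norm_nonneg _)] at h
    refine h.congr_fderiv ?_
    ext z
    simp
    field_simp
  rw [← hasFDerivWithinAt_univ, hasFDerivWithinAt_euclidean]
  intro i
  have hl : ∀ j, HasFDerivAt (fun z : EuclideanSpace ℝ (Fin 3) => z j)
      (EuclideanSpace.proj j : EuclideanSpace ℝ (Fin 3) →L[ℝ] ℝ) y := fun j =>
    (EuclideanSpace.proj j : EuclideanSpace ℝ (Fin 3) →L[ℝ] ℝ).hasFDerivAt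
  have h := ((((hl 0).const_mul (toMat g (Sum.inl i) (Sum.inl 0))).add
    ((hl 1).const_mul (toMat g (Sum.inl i) (Sum.inl 1)))).add
    ((hl 2).const_mul (toMat g (Sum.inl i) (Sum.inl 2)))).add
    (hn.const_mul (toMat g (Sum.inl i) (Sum.inr ())))
  refine (h.congr_fderiv ?_).hasFDerivWithinAt.congr_of_eventuallyEq (.of_forall fun z => ?_) ?_
  rotate_left
  · simp [coneMap, Matrix.mulVec, dotProduct, coneVec, Fin.sum_univ_three]
  · simp [coneMap, Matrix.mulVec, dotProduct, coneVec, Fin.sum_univ_three]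
  · ext z
    simp [coneDeriv, Matrix.mulVec, dotProduct, Fin.sum_univ_three, dir, PiLp.inner_apply,
      Matrix.toBlocks₁₁]
    ring

theorem det_fderiv_coneMap (g : SO31) (x : S2) :
    (LinearMap.toContinuousLinearMap (Matrix.toEuclideanLin (coneDeriv g x))).det
      = timeFactor g x := by
  rw [← det_coneDeriv, LinearMap.det_toContinuousLinearMap]
  exact LinearMap.det_toLin (PiLp.basisFun 2 ℝ (Fin 3)) _

/-- Integration in polar coordinates over the part of `ℝ³` where `‖y‖ * t < 1`, for a function of
the direction. -/
theorem lintegral_cone (F : S2 → ℝ≥0∞) (hF : Measurable F) (t : S2 → ℝ) (ht : Continuous t)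
    (ht0 : ∀ x, 0 < t x) (Φ : EuclideanSpace ℝ (Fin 3) → ℝ≥0∞)
    (hΦ : ∀ (x : S2) (r : ℝ), 0 < r → Φ (r • x.1) = if r * t x < 1 then F x else 0) :
    ∫⁻ y in {0}ᶜ, Φ y = ∫⁻ x, F x * ENNReal.ofReal ((t x)⁻¹ ^ 3 / 3)
      ∂(volume : Measure (EuclideanSpace ℝ (Fin 3))).toSphere := by
  have hp :=
    (volume : Measure (EuclideanSpace ℝ (Fin 3))).measurePreserving_homeomorphUnitSphereProd
  rw [← lintegral_subtype_comap (measurableSet_singleton _).compl]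
  let H : S2 × Set.Ioi (0 : ℝ) → ℝ≥0∞ := fun p => if p.2.1 * t p.1 < 1 then F p.1 else 0
  have hH : Measurable H := by
    refine Measurable.ite ?_ (hF.comp measurable_fst) measurable_const
    exact (isOpen_lt (by fun_prop) continuous_const).measurableSet
  have e : ∀ y : ({0}ᶜ : Set (EuclideanSpace ℝ (Fin 3))),
      Φ y.1 = H (homeomorphUnitSphereProd _ y) := by
    intro y
    have h0 : 0 < ‖y.1‖ := norm_pos_iff.2 y.2
    have := hΦ (homeomorphUnitSphereProd _ y).1 ‖y.1‖ h0
    simp only [H]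
    rw [homeomorphUnitSphereProd_apply_snd_coe, ← this, homeomorphUnitSphereProd_apply_fst_coe,
      smul_smul, mul_inv_cancel₀ h0.ne', one_smul]
  simp_rw [e]
  rw [hp.lintegral_comp hH, lintegral_prod _ hH.aemeasurable]
  refine lintegral_congr fun x => ?_
  have hx := ht0 x
  have hi : ∀ r : Set.Ioi (0 : ℝ), H (x, r)
      = (Set.Iio (⟨(t x)⁻¹, inv_pos.2 hx⟩ : Set.Ioi (0 : ℝ))).indicator (fun _ => F x) r := by
    intro r
    simp only [H, Set.indicator, Set.mem_Iio, ← Subtype.coe_lt_coe]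
    congr 1
    rw [lt_inv_comm₀ r.2 hx, inv_eq_one_div, lt_div_iff₀ r.2, mul_comm]
  simp_rw [hi]
  rw [lintegral_indicator measurableSet_Iio, setLIntegral_const, Measure.volumeIoiPow_apply_Iio]
  simp
  norm_num

/-- The Lebesgue change of variables for `coneMap g`, in polar coordinates: the Jacobian is `t_g`,
and the radius of the unit ball is divided by `t_g`, which gives the density
`t_g · t_g⁻³ = t_g⁻²`. -/
theorem lintegral_smul_toSphere (g : SO31) (F : S2 → ℝ≥0∞) (hF : Measurable F) :
    ∫⁻ x, F (g • x) * ENNReal.ofReal ((timeFactor g x)⁻¹ ^ 2)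
      ∂(volume : Measure (EuclideanSpace ℝ (Fin 3))).toSphere =
    ∫⁻ x, F x ∂(volume : Measure (EuclideanSpace ℝ (Fin 3))).toSphere := by
  classical
  -- `F` of the direction, cut off to the unit ball: its integral is a third of that of `F`
  let Φ : EuclideanSpace ℝ (Fin 3) → ℝ≥0∞ := fun y =>
    if h : y ≠ 0 then (if ‖y‖ < 1 then F (dir y h) else 0) else 0
  have hdir : ∀ (x : S2) (r : ℝ) (hr : 0 < r) (h : r • x.1 ≠ 0), dir (r • x.1) h = x := by
    intro x r hr h
    have hx : ‖x.1‖ = 1 := norm_eq_of_mem_sphere x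
    apply Subtype.ext
    simp [dir, norm_smul, hx, abs_of_pos hr, smul_smul, inv_mul_cancel₀ hr.ne']
  have hne : ∀ (x : S2) (r : ℝ) (hr : 0 < r), r • x.1 ≠ 0 := by
    intro x r hr h
    have hx : ‖x.1‖ = 1 := norm_eq_of_mem_sphere x
    have := congrArg norm h
    simp [norm_smul, hx, hr.ne'] at this
  have hΦ : ∀ (x : S2) (r : ℝ), 0 < r → Φ (r • x.1) = if r < 1 then F x else 0 := by
    intro x r hr
    have hx : ‖x.1‖ = 1 := norm_eq_of_mem_sphere x
    simp only [Φ, dif_pos (hne x r hr), hdir x r hr]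
    simp [norm_smul, hx, abs_of_pos hr]
  have h1 := lintegral_cone F hF (fun _ => 1) continuous_const (fun _ => one_pos) Φ
    (by simpa using hΦ)
  have himg : coneMap g '' {0}ᶜ = {0}ᶜ := by
    have h0 : coneMap g 0 = 0 := by
      have h0 : coneVec 0 = 0 := by
        funext i; rcases i with i | i <;> simp [coneVec]
      ext i; simp [coneMap, h0]
    rw [Set.image_compl_eq ⟨coneMap_injective g, coneMap_surjective g⟩, Set.image_singleton, h0]
  let f' : EuclideanSpace ℝ (Fin 3) → (EuclideanSpace ℝ (Fin 3) →L[ℝ] EuclideanSpace ℝ (Fin 3)) :=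
    fun y => if h : y ≠ 0 then
      LinearMap.toContinuousLinearMap (Matrix.toEuclideanLin (coneDeriv g (dir y h))) else 0
  have h2 := lintegral_image_eq_lintegral_abs_det_fderiv_mul volume
    (measurableSet_singleton (0 : EuclideanSpace ℝ (Fin 3))).compl (f := coneMap g) (f' := f')
    (fun y hy => by
      have hy' : y ≠ 0 := hy
      simp only [f', dif_pos hy']
      exact (hasFDerivAt_coneMap g y hy').hasFDerivWithinAt)
    (coneMap_injective g).injOn Φ
  have h3 := lintegral_cone (fun x => ENNReal.ofReal (timeFactor g x) * F (g • x))
    ((continuous_timeFactor g).measurable.ennreal_ofReal.mul (hF.comp (measurable_smul_S2 g)))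
    (timeFactor g) (continuous_timeFactor g) (timeFactor_pos g)
    (fun y => ENNReal.ofReal |(f' y).det| * Φ (coneMap g y)) (by
      intro x r hr
      have ht := timeFactor_pos g x
      rw [coneMap_smul g x hr.le, hΦ _ _ (mul_pos hr ht)]
      simp only [f', dif_pos (hne x r hr), hdir x r hr, det_fderiv_coneMap, abs_of_pos ht]
      split_ifs <;> simp)
  rw [himg, h1, h3] at h2
  have c3 : ENNReal.ofReal ((1 : ℝ)⁻¹ ^ 3 / 3) * 3 = 1 := by
    rw [← ENNReal.ofReal_ofNat, ← ENNReal.ofReal_mul (by norm_num)]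
    norm_num
  have h4 := congrArg (· * (3 : ℝ≥0∞)) h2
  rw [← lintegral_mul_const' _ _ (by simp), ← lintegral_mul_const' _ _ (by simp)] at h4
  simp only [mul_assoc, c3, mul_one] at h4
  rw [h4]
  refine lintegral_congr fun x => ?_
  have ht := timeFactor_pos g x
  have h5 : ENNReal.ofReal ((timeFactor g x)⁻¹ ^ 2) = ENNReal.ofReal (timeFactor g x) *
      (ENNReal.ofReal ((timeFactor g x)⁻¹ ^ 3 / 3) * ENNReal.ofReal 3) := by
    rw [← ENNReal.ofReal_mul (by positivity), ← ENNReal.ofReal_mul (by positivity)]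
    congr 1
    field_simp
  rw [ENNReal.ofReal_ofNat] at h5
  rw [h5]
  ring

instance : IsProbabilityMeasure m := by
  constructor
  rw [m, Measure.smul_apply, smul_eq_mul, ENNReal.inv_mul_cancel]
  · simp [Real.pi_pos]
  · exact measure_ne_top _ _

/-- The density of `g⁻¹_* m` with respect to `m` is `t_g⁻²`. -/
theorem lintegral_smul_m (g : SO31) (F : S2 → ℝ≥0∞) (hF : Measurable F) :
    ∫⁻ x, F (g • x) * ENNReal.ofReal ((timeFactor g x)⁻¹ ^ 2) ∂m = ∫⁻ x, F x ∂m := by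
  simp only [m, lintegral_smul_measure, lintegral_smul_toSphere g F hF]

theorem volume_real_unit_ball_pos :
    0 < (volume : Measure (EuclideanSpace ℝ (Fin 3))).real (Metric.ball 0 1) :=
  ENNReal.toReal_pos (Metric.measure_ball_pos _ _ one_pos).ne' measure_ball_lt_top.ne

/-- Balls of radius `r` in the sphere have measure at least a multiple of `r ^ 3`. -/
theorem exists_ball_bound : ∃ c : ℝ, 0 < c ∧ ∀ (x : S2) (r : ℝ), 0 < r → r ≤ 1 →
    c * r ^ 3 ≤ m.real (Metric.ball x r) := by
  set σ := (volume : Measure (EuclideanSpace ℝ (Fin 3))).toSphere with hσ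
  have hu : 0 < σ.real Set.univ := by
    have := volume_real_unit_ball_pos
    rw [hσ, Measure.toSphere_real_apply_univ]
    simpa using this
  refine ⟨(σ.real Set.univ)⁻¹ * (3 * (1 / 4) ^ 3 *
    (volume : Measure (EuclideanSpace ℝ (Fin 3))).real (Metric.ball 0 1)), ?_, ?_⟩
  · have := volume_real_unit_ball_pos
    positivity
  · intro x r hr hr1
    have h := Measure.toSphereBallBound_mul_measureReal_unitBall_le_toSphere_ball
      (volume : Measure (EuclideanSpace ℝ (Fin 3))) hr x
    have hb : (Measure.toSphereBallBound (Module.finrank ℝ (EuclideanSpace ℝ (Fin 3))) r : ℝ)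
        = 3 * (r / 4) ^ 3 := by
      have h2 : min r.toNNReal 2 = r.toNNReal := min_eq_left (by
        rw [Real.toNNReal_le_iff_le_coe]; push_cast; linarith)
      unfold Measure.toSphereBallBound
      simp [hr, h2, hr.le]
    rw [hb] at h
    have hm : m.real (Metric.ball x r) = (σ.real Set.univ)⁻¹ * σ.real (Metric.ball x r) := by
      simp [m, measureReal_def, hσ]
    rw [hm, mul_assoc]
    gcongr
    refine le_trans (le_of_eq ?_) h
    ring

instance : m.IsOpenPosMeasure := by
  constructor
  intro U hU hne
  obtain ⟨x, hx⟩ := hne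
  obtain ⟨r, hr, hrU⟩ := Metric.isOpen_iff.1 hU x hx
  obtain ⟨c, hc, h⟩ := exists_ball_bound
  have h1 := h x (min r 1) (by positivity) (min_le_right _ _)
  have h2 : 0 < m.real (Metric.ball x (min r 1)) := lt_of_lt_of_le (by positivity) h1
  intro h0
  have h3 : m (Metric.ball x (min r 1)) ≤ m U :=
    measure_mono ((Metric.ball_subset_ball (min_le_left _ _)).trans hrU)
  rw [h0, nonpos_iff_eq_zero] at h3
  simp [measureReal_def, h3] at h2

theorem map_smul_m (g : SO31) :
    m.map (fun x => g • x) = m.withDensity fun x => ENNReal.ofReal ((timeFactor g⁻¹ x)⁻¹ ^ 2) := by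
  have hd : Measurable fun x => ENNReal.ofReal ((timeFactor g⁻¹ x)⁻¹ ^ 2) :=
    ((continuous_timeFactor g⁻¹).measurable.inv.pow_const 2).ennreal_ofReal
  refine Measure.ext_of_lintegral _ fun F hF => ?_
  rw [lintegral_map hF (measurable_smul_S2 g), lintegral_withDensity_eq_lintegral_mul _ hd hF,
    ← lintegral_smul_m g _ (hd.mul hF)]
  refine lintegral_congr fun x => ?_
  have ht := timeFactor_pos g x
  have e : timeFactor g⁻¹ (g • x) = (timeFactor g x)⁻¹ := by
    rw [timeFactor_inv, inv_smul_smul]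
  rw [Pi.mul_apply, e, mul_comm, ← mul_assoc, ← ENNReal.ofReal_mul (by positivity), inv_inv,
    ← mul_pow, inv_mul_cancel₀ ht.ne']
  simp

theorem quasiMeasurePreserving_smul (g : SO31) :
    Measure.QuasiMeasurePreserving (fun x : S2 => g • x) m m :=
  ⟨measurable_smul_S2 g, by rw [map_smul_m]; exact withDensity_absolutelyContinuous _ _⟩

theorem lintegral_smul_m₀ (g : SO31) (F : S2 → ℝ≥0∞) (hF : AEMeasurable F m) :
    ∫⁻ x, F (g • x) * ENNReal.ofReal ((timeFactor g x)⁻¹ ^ 2) ∂m = ∫⁻ x, F x ∂m := by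
  rw [lintegral_congr_ae hF.ae_eq_mk, ← lintegral_smul_m g _ hF.measurable_mk]
  refine lintegral_congr_ae ?_
  filter_upwards [(quasiMeasurePreserving_smul g).ae_eq_comp hF.ae_eq_mk] with x hx
  simp only [Function.comp_apply] at hx
  rw [hx]

/-! ### Composition operators on `L²` -/

theorem eLpNorm_weighted_comp_le (g : SO31) {w : S2 → ℝ} {C : ℝ}
    (hC : ∀ x, |w x| * timeFactor g x ≤ C) {f : S2 → ℝ} (hf : AEStronglyMeasurable f m) :
    eLpNorm (fun x => w x * f (g • x)) 2 m ≤ ENNReal.ofReal C * eLpNorm f 2 m := by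
  rw [eLpNorm_eq_lintegral_rpow_enorm_toReal (by norm_num) (by norm_num),
    eLpNorm_eq_lintegral_rpow_enorm_toReal (by norm_num) (by norm_num)]
  have hm : AEMeasurable (fun x => ‖f x‖ₑ ^ (2 : ℝ≥0∞).toReal) m := hf.enorm.pow_const _
  rw [← lintegral_smul_m₀ g _ hm]
  have hle : ∫⁻ x, ‖w x * f (g • x)‖ₑ ^ (2 : ℝ≥0∞).toReal ∂m ≤
      ENNReal.ofReal C ^ (2 : ℝ) * ∫⁻ x, ‖f (g • x)‖ₑ ^ (2 : ℝ≥0∞).toReal *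
        ENNReal.ofReal ((timeFactor g x)⁻¹ ^ 2) ∂m := by
    rw [← lintegral_const_mul' _ _ (by simp)]
    refine lintegral_mono fun x => ?_
    have ht := timeFactor_pos g x
    have h1 : ‖w x‖ₑ ≤ ENNReal.ofReal C * ENNReal.ofReal (timeFactor g x)⁻¹ := by
      have hC0 : 0 ≤ C := (by positivity : 0 ≤ |w x| * timeFactor g x).trans (hC x)
      rw [← ENNReal.ofReal_mul hC0, Real.enorm_eq_ofReal_abs]
      refine ENNReal.ofReal_le_ofReal ?_
      rw [← div_eq_mul_inv, le_div_iff₀ ht]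
      exact hC x
    rw [enorm_mul, ENNReal.mul_rpow_of_nonneg _ _ (by norm_num)]
    calc ‖w x‖ₑ ^ (2 : ℝ≥0∞).toReal * ‖f (g • x)‖ₑ ^ (2 : ℝ≥0∞).toReal
        ≤ (ENNReal.ofReal C * ENNReal.ofReal (timeFactor g x)⁻¹) ^ (2 : ℝ≥0∞).toReal
          * ‖f (g • x)‖ₑ ^ (2 : ℝ≥0∞).toReal := by gcongr
      _ = _ := by
        rw [ENNReal.mul_rpow_of_nonneg _ _ (by norm_num), ENNReal.ofReal_pow (by positivity)]
        simp
        ring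
  calc _ ≤ (ENNReal.ofReal C ^ (2 : ℝ) * ∫⁻ x, ‖f (g • x)‖ₑ ^ (2 : ℝ≥0∞).toReal *
        ENNReal.ofReal ((timeFactor g x)⁻¹ ^ 2) ∂m) ^ (1 / (2 : ℝ≥0∞).toReal) := by gcongr
    _ = _ := by
      rw [ENNReal.mul_rpow_of_nonneg _ _ (by norm_num), ← ENNReal.rpow_mul]
      norm_num

/-- The real Hilbert space `L²(S², m)`. -/
abbrev H : Type := Lp ℝ 2 m

theorem memLp_weighted_comp (g : SO31) (w : C(S2, ℝ)) {f : S2 → ℝ} (hf : MemLp f 2 m) :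
    MemLp (fun x => w x * f (g • x)) 2 m := by
  refine ⟨w.continuous.aestronglyMeasurable.mul
    (hf.1.comp_quasiMeasurePreserving (quasiMeasurePreserving_smul g)), ?_⟩
  let t : C(S2, ℝ) := ⟨timeFactor g, continuous_timeFactor g⟩
  have hC : ∀ x, |w x| * timeFactor g x ≤ ‖w‖ * ‖t‖ := fun x => by
    have h1 := w.norm_coe_le_norm x
    have h2 := (le_abs_self _).trans (t.norm_coe_le_norm x)
    exact mul_le_mul h1 h2 (timeFactor_pos g x).le (norm_nonneg _)
  exact (eLpNorm_weighted_comp_le g hC hf.1).trans_lt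
    (ENNReal.mul_lt_top ENNReal.ofReal_lt_top hf.2)

/-- The weighted composition operator `f ↦ w · (f ∘ g)` on `L²(S², m)`. -/
def wcomp (g : SO31) (w : C(S2, ℝ)) : H →L[ℝ] H :=
  LinearMap.mkContinuous
    { toFun := fun f => (memLp_weighted_comp g w (Lp.memLp f)).toLp _
      map_add' := fun f₁ f₂ => by
        rw [← MemLp.toLp_add]
        refine MemLp.toLp_congr _ _ ?_
        filter_upwards [(quasiMeasurePreserving_smul g).ae_eq_comp (Lp.coeFn_add f₁ f₂)] with x hx
        simp only [Function.comp_apply] at hx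
        simp only [hx, Pi.add_apply]
        ring
      map_smul' := fun c f => by
        rw [RingHom.id_apply, ← MemLp.toLp_const_smul]
        refine MemLp.toLp_congr _ _ ?_
        filter_upwards [(quasiMeasurePreserving_smul g).ae_eq_comp (Lp.coeFn_smul c f)] with x hx
        simp only [Function.comp_apply] at hx
        simp only [hx, Pi.smul_apply, smul_eq_mul]
        ring }
    (‖w‖ * ‖(⟨timeFactor g, continuous_timeFactor g⟩ : C(S2, ℝ))‖) fun f => by
      have hC : ∀ x, |w x| * timeFactor g x ≤
          ‖w‖ * ‖(⟨timeFactor g, continuous_timeFactor g⟩ : C(S2, ℝ))‖ := fun x => by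
        have h1 := w.norm_coe_le_norm x
        have h2 := (le_abs_self _).trans
          ((⟨timeFactor g, continuous_timeFactor g⟩ : C(S2, ℝ)).norm_coe_le_norm x)
        exact mul_le_mul h1 h2 (timeFactor_pos g x).le (norm_nonneg _)
      have h := eLpNorm_weighted_comp_le g hC (Lp.aestronglyMeasurable f)
      have h2 := ENNReal.toReal_mono (ENNReal.mul_ne_top ENNReal.ofReal_ne_top
        (Lp.eLpNorm_ne_top f)) h
      rw [ENNReal.toReal_mul, ENNReal.toReal_ofReal (by positivity), ← Lp.norm_def] at h2
      simpa only [LinearMap.coe_mk, AddHom.coe_mk, Lp.norm_toLp] using h2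

theorem coeFn_wcomp (g : SO31) (w : C(S2, ℝ)) (f : H) :
    wcomp g w f =ᵐ[m] fun x => w x * f (g • x) :=
  MemLp.coeFn_toLp (memLp_weighted_comp g w (Lp.memLp f))

theorem norm_wcomp_le (g : SO31) (w : C(S2, ℝ)) {C : ℝ} (hC : ∀ x, |w x| * timeFactor g x ≤ C) :
    ‖wcomp g w‖ ≤ C := by
  have hC0 : 0 ≤ C := by
    obtain ⟨x⟩ : Nonempty S2 := nonempty_of_isProbabilityMeasure m
    exact (mul_nonneg (abs_nonneg _) (timeFactor_pos g x).le).trans (hC x)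
  refine ContinuousLinearMap.opNorm_le_bound _ hC0 fun f => ?_
  have h := eLpNorm_weighted_comp_le g hC (Lp.aestronglyMeasurable f)
  have h2 := ENNReal.toReal_mono (ENNReal.mul_ne_top ENNReal.ofReal_ne_top
    (Lp.eLpNorm_ne_top f)) h
  rw [ENNReal.toReal_mul, ENNReal.toReal_ofReal hC0, ← Lp.norm_def] at h2
  rw [Lp.norm_def, eLpNorm_congr_ae (coeFn_wcomp g w f)]
  exact h2

theorem wcomp_wcomp (g h : SO31) (w w' w'' : C(S2, ℝ)) (hw : ∀ x, w'' x = w' x * w (h • x)) :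
    wcomp h w' * wcomp g w = wcomp (g * h) w'' := by
  ext1 f
  refine Lp.ext ?_
  filter_upwards [coeFn_wcomp h w' (wcomp g w f), coeFn_wcomp (g * h) w'' f,
    (quasiMeasurePreserving_smul h).ae_eq_comp (coeFn_wcomp g w f)] with x h1 h2 h3
  simp only [Function.comp_apply] at h3
  rw [mul_apply_eq_comp, h1, h2, h3, hw, mul_smul, mul_assoc]

/-- The Koopman operator `f ↦ f ∘ g` on `L²(S², m)`. -/
def koopman (g : SO31) : H →L[ℝ] H := wcomp g 1

/-- The half-density `x ↦ t_g(x)⁻¹`, the square root of `d(g⁻¹_* m)/dm`. -/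
def halfDensity (g : SO31) : C(S2, ℝ) :=
  ⟨fun x => (timeFactor g x)⁻¹,
    (continuous_timeFactor g).inv₀ fun x => (timeFactor_pos g x).ne'⟩

/-- The unitary Koopman operator `f ↦ t_g⁻¹ · (f ∘ g)` on `L²(S², m)`. -/
def unitaryKoopman (g : SO31) : H →L[ℝ] H := wcomp g (halfDensity g)

theorem koopman_mul (g h : SO31) : koopman (g * h) = koopman h * koopman g :=
  (wcomp_wcomp g h _ _ _ (by simp)).symm

theorem unitaryKoopman_mul (g h : SO31) :
    unitaryKoopman (g * h) = unitaryKoopman h * unitaryKoopman g :=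
  (wcomp_wcomp g h _ _ _ fun x => by
    simp only [halfDensity, ContinuousMap.coe_mk, timeFactor_mul, mul_inv]
    ring).symm

theorem koopman_one : koopman 1 = 1 := by
  ext1 f
  refine Lp.ext ?_
  filter_upwards [coeFn_wcomp 1 1 f] with x h1
  simp only [koopman, h1]
  simp

theorem norm_koopman_le {g : SO31} {C : ℝ} (hC : ∀ x, timeFactor g x ≤ C) : ‖koopman g‖ ≤ C :=
  norm_wcomp_le g 1 (by simpa using hC)

theorem norm_unitaryKoopman_le (g : SO31) : ‖unitaryKoopman g‖ ≤ 1 :=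
  norm_wcomp_le g _ fun x => by
    have ht := timeFactor_pos g x
    simp only [halfDensity, ContinuousMap.coe_mk, abs_of_pos (inv_pos.2 ht)]
    rw [inv_mul_cancel₀ ht.ne']

theorem unitaryKoopman_eq_koopman {g : SO31} (hg : ∀ x, timeFactor g x = 1) :
    unitaryKoopman g = koopman g := by
  unfold unitaryKoopman koopman
  congr 1
  ext x
  simp [halfDensity, hg]

theorem unitaryKoopman_one : unitaryKoopman 1 = 1 := by
  rw [unitaryKoopman_eq_koopman timeFactor_one, koopman_one]

/-- The inclusion of the continuous functions in `L²(S², m)`. -/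
abbrev toH : C(S2, ℝ) →L[ℝ] H := ContinuousMap.toLp 2 m ℝ

/-- Composition with `g`, on the continuous functions. -/
def compC (g : SO31) : C(S2, ℝ) →L[ℝ] C(S2, ℝ) :=
  LinearMap.mkContinuous
    { toFun := fun f => f.comp ⟨fun x => g • x, continuous_smul_S2 g⟩
      map_add' := fun _ _ => rfl
      map_smul' := fun _ _ => rfl } 1 fun f => by
    rw [one_mul]
    exact (ContinuousMap.norm_le _ (norm_nonneg _)).2 fun x => f.norm_coe_le_norm _

@[simp] theorem compC_apply (g : SO31) (f : C(S2, ℝ)) (x : S2) : compC g f x = f (g • x) := rfl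

theorem norm_compC_le (g : SO31) : ‖compC g‖ ≤ 1 := LinearMap.mkContinuous_norm_le _ zero_le_one _

theorem wcomp_toH (g : SO31) (w f : C(S2, ℝ)) : wcomp g w (toH f) = toH (w * compC g f) := by
  refine Lp.ext ?_
  filter_upwards [coeFn_wcomp g w (toH f),
    ContinuousMap.coeFn_toLp (𝕜 := ℝ) (p := 2) m (w * compC g f),
    (quasiMeasurePreserving_smul g).ae_eq_comp
      (ContinuousMap.coeFn_toLp (𝕜 := ℝ) (p := 2) m f)] with x h1 h2 h3
  simp only [Function.comp_apply] at h3
  rw [h1, h2, h3]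
  simp

theorem koopman_toH (g : SO31) (f : C(S2, ℝ)) : koopman g (toH f) = toH (compC g f) := by
  rw [koopman, wcomp_toH, one_mul]

theorem inner_toH (f : C(S2, ℝ)) (u : H) : inner ℝ (toH f) u = ∫ x, f x * u x ∂m := by
  rw [L2.inner_def]
  refine integral_congr_ae ?_
  filter_upwards [ContinuousMap.coeFn_toLp (𝕜 := ℝ) (p := 2) m f] with x hx
  rw [hx]
  simp [mul_comm]

theorem inner_one (u : H) : inner ℝ (toH 1) u = ∫ x, u x ∂m := by
  simp [inner_toH]

theorem inner_one_toH (f : C(S2, ℝ)) : inner ℝ (toH 1) (toH f) = ∫ x, f x ∂m := by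
  rw [inner_one]
  exact integral_congr_ae (ContinuousMap.coeFn_toLp (𝕜 := ℝ) (p := 2) m f)

theorem norm_one_H : ‖toH 1‖ = 1 := by
  have h := real_inner_self_eq_norm_sq (toH 1)
  rw [inner_one_toH] at h
  simp at h
  nlinarith [norm_nonneg (toH 1)]

theorem koopman_toH_one (g : SO31) : koopman g (toH 1) = toH 1 := by
  rw [koopman_toH]; rfl

theorem norm_toH_sq (f : C(S2, ℝ)) : ‖toH f‖ ^ 2 = ∫ x, f x ^ 2 ∂m := by
  rw [← real_inner_self_eq_norm_sq, inner_toH]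
  refine integral_congr_ae ?_
  filter_upwards [ContinuousMap.coeFn_toLp (𝕜 := ℝ) (p := 2) m f] with x hx
  rw [hx, sq]

/-! ### Lipschitz functions which are small in `L²` -/

/-- If `l r ≤ M / 2`, then a function of Lipschitz constant `l` whose absolute value reaches `M` at
a point stays above `M / 2` on the ball of radius `r`, and so its `L²` norm is not small. -/
theorem exists_lipschitz_bound : ∃ c : ℝ, 0 < c ∧ ∀ (f : C(S2, ℝ)) (l M r : ℝ) (x : S2), 0 ≤ l →
    (∀ y z, |f y - f z| ≤ l * dist y z) → 0 < M → M ≤ |f x| → 0 < r → r ≤ 1 → l * r ≤ M / 2 →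
    c * M ^ 2 * r ^ 3 ≤ ‖toH f‖ ^ 2 := by
  obtain ⟨c, hc, hball⟩ := exists_ball_bound
  refine ⟨c / 4, by positivity, fun f l M r x hl hf hM hMx hr hr1 hlr => ?_⟩
  have hint : Integrable (fun y => f y ^ 2) m := by
    have : Continuous fun y => f y ^ 2 := by fun_prop
    exact (BoundedContinuousFunction.mkOfCompact ⟨_, this⟩).integrable m
  have h1 := mul_meas_ge_le_integral_of_nonneg (μ := m) (f := fun y => f y ^ 2)
    (Filter.Eventually.of_forall fun y => sq_nonneg _) hint ((M / 2) ^ 2)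
  rw [norm_toH_sq]
  refine le_trans ?_ h1
  have h2 : m.real (Metric.ball x r) ≤ m.real {y | (M / 2) ^ 2 ≤ f y ^ 2} := by
    refine measureReal_mono fun y hy => ?_
    have h3 := hf x y
    have h4 : l * dist x y ≤ l * r :=
      mul_le_mul_of_nonneg_left (by rw [dist_comm]; exact (Metric.mem_ball.1 hy).le) hl
    have h5 := abs_sub_abs_le_abs_sub (f x) (f y)
    have h6 : M / 2 ≤ |f y| := by linarith
    change (M / 2) ^ 2 ≤ f y ^ 2
    rw [← sq_abs (f y)]
    gcongr
  have h7 := hball x r hr hr1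
  calc c / 4 * M ^ 2 * r ^ 3 = (M / 2) ^ 2 * (c * r ^ 3) := by ring
    _ ≤ _ := by gcongr; exact h7.trans h2

/-! ### The spectral gap -/

theorem norm_koopman_le_one_of_mem_K {g : SO31} (hg : g ∈ K) : ‖koopman g‖ ≤ 1 :=
  norm_koopman_le fun x => (timeFactor_eq_one_of_mem_K hg x).le

theorem norm_koopman_inv_le_one_of_mem_K {g : SO31} (hg : g ∈ K) : ‖koopman g⁻¹‖ ≤ 1 :=
  norm_koopman_le fun x => (timeFactor_inv_eq_one_of_mem_K hg x).le

theorem norm_sum_koopman_apply_le {ι : Type*} (s : Finset ι) (r : ι → SO31)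
    (hs : ∀ i ∈ s, r i ∈ K) (F : H) :
    ‖∑ i ∈ s, (koopman (r i) F + koopman (r i)⁻¹ F)‖ ≤ 2 * s.card * ‖F‖ := by
  refine (norm_sum_le_of_le s (fun i hi => ?_ : ∀ i ∈ s, _ ≤ 2 * ‖F‖)).trans ?_
  · refine (norm_add_le _ _).trans ?_
    have h1 := (koopman (r i)).le_of_opNorm_le (norm_koopman_le_one_of_mem_K (hs i hi)) F
    have h2 := (koopman (r i)⁻¹).le_of_opNorm_le (norm_koopman_inv_le_one_of_mem_K (hs i hi)) F
    linarith
  · rw [Finset.sum_const, nsmul_eq_mul]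
    linarith

/-- The `L²` norm in the definition of `kappa`, in terms of Koopman operators. -/
theorem toReal_eLpNorm_average (C : Finset SO31) {f : S2 → ℝ} (hf : MemLp f 2 m) :
    (eLpNorm (fun x => (2 * (C.card : ℝ))⁻¹ * ∑ c ∈ C, (f (c • x) + f (c⁻¹ • x))) 2 m).toReal =
      (2 * (C.card : ℝ))⁻¹ *
        ‖∑ c ∈ C, (koopman c (hf.toLp f) + koopman c⁻¹ (hf.toLp f))‖ := by
  rw [← Real.norm_of_nonneg (show 0 ≤ (2 * (C.card : ℝ))⁻¹ by positivity), ← norm_smul,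
    Lp.norm_def]
  refine congrArg _ (eLpNorm_congr_ae ?_)
  have hk : ∀ c : SO31, koopman c (hf.toLp f) =ᵐ[m] fun x => f (c • x) := fun c => by
    filter_upwards [coeFn_wcomp c 1 (hf.toLp f),
      (quasiMeasurePreserving_smul c).ae_eq_comp hf.coeFn_toLp] with x h1 h2
    simp only [Function.comp_apply] at h2
    rw [koopman, h1, h2]
    simp
  have hsum : ∀ᵐ x ∂m, ∀ c ∈ C, (koopman c (hf.toLp f) + koopman c⁻¹ (hf.toLp f) : H) x
      = f (c • x) + f (c⁻¹ • x) := by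
    refine (Filter.eventually_all_finset C).2 fun c _ => ?_
    filter_upwards [hk c, hk c⁻¹, Lp.coeFn_add (koopman c (hf.toLp f))
      (koopman c⁻¹ (hf.toLp f))] with x h1 h2 h3
    rw [h3, Pi.add_apply, h1, h2]
  filter_upwards [hsum, Lp.coeFn_smul (2 * (C.card : ℝ))⁻¹
    (∑ c ∈ C, (koopman c (hf.toLp f) + koopman c⁻¹ (hf.toLp f))),
    Lp.coeFn_finsetSum C (fun c => koopman c (hf.toLp f) + koopman c⁻¹ (hf.toLp f))] with x h1 h2 h3
  rw [h2, Pi.smul_apply, smul_eq_mul, h3, Finset.sum_apply, Finset.sum_congr rfl h1,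
    Real.norm_of_nonneg (by positivity)]

theorem norm_sum_koopman_le_kappa (C : Finset SO31) (hC : ∀ c ∈ C, c ∈ K) (hne : C.Nonempty)
    (F : H) (hF : inner ℝ (toH 1) F = 0) :
    ‖∑ c ∈ C, (koopman c F + koopman c⁻¹ F)‖ ≤ 2 * C.card * (1 - kappa C) * ‖F‖ := by
  rcases eq_or_ne F 0 with rfl | h0
  · simp
  have hF0 : 0 < ‖F‖ := norm_pos_iff.2 h0
  have hcard : (0 : ℝ) < C.card := by exact_mod_cast hne.card_pos
  set G : H := ‖F‖⁻¹ • F with hG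
  have hGn : ‖G‖ = 1 := by rw [hG, norm_smul, norm_inv, norm_norm, inv_mul_cancel₀ hF0.ne']
  have hle : (2 * (C.card : ℝ))⁻¹ * ‖∑ c ∈ C, (koopman c G + koopman c⁻¹ G)‖ ≤ 1 - kappa C := by
    unfold kappa
    rw [sub_sub_cancel]
    refine le_csSup ⟨1, ?_⟩ ⟨G, Lp.memLp G, ?_, ?_, ?_⟩
    · rintro r ⟨f, hf, -, hn, rfl⟩
      rw [toReal_eLpNorm_average C hf, inv_mul_le_iff₀ (by positivity)]
      have := norm_sum_koopman_apply_le C id hC (hf.toLp f)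
      rw [Lp.norm_toLp, hn] at this
      rw [ENNReal.toReal_one] at this
      simpa only [id_eq] using this
    · rw [← inner_one, hG, inner_smul_right, hF, mul_zero]
    · rw [Lp.norm_def] at hGn
      exact ((ENNReal.toReal_eq_one_iff _).1 hGn)
    · rw [toReal_eLpNorm_average C (Lp.memLp G), Lp.toLp_coeFn G (Lp.memLp G)]
  have hFG : F = ‖F‖ • G := by rw [hG, smul_smul, mul_inv_cancel₀ hF0.ne', one_smul]
  rw [inv_mul_le_iff₀ (mul_pos two_pos hcard)] at hle
  have e : ∑ c ∈ C, (koopman c F + koopman c⁻¹ F)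
      = ‖F‖ • ∑ c ∈ C, (koopman c G + koopman c⁻¹ G) := by
    rw [Finset.smul_sum]
    refine Finset.sum_congr rfl fun c _ => ?_
    rw [smul_add, ← map_smul, ← map_smul, ← hFG]
  rw [e, norm_smul, norm_norm, mul_comm]
  gcongr

/-- The sum is over `B` and not over its image, on which the gap is defined. Elements with the same
image do no harm: the gap is used on a set of representatives, and the other terms are bounded
trivially. -/
theorem norm_sum_koopman_le_repGap {Γ : Type*} [Group Γ] (B : Finset Γ) (hB : B.Nonempty)
    (ρ : Γ →* SO31) (hK : ∀ b ∈ B, ρ b ∈ K) {κ₀ : ℝ} (hκ₀ : 0 ≤ κ₀) (hκ : κ₀ ≤ repGap B ρ)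
    (F : H) (hF : inner ℝ (toH 1) F = 0) :
    ‖∑ b ∈ B, (koopman (ρ b) F + koopman (ρ b)⁻¹ F)‖ ≤ (2 * B.card - 2 * κ₀) * ‖F‖ := by
  classical
  obtain ⟨B', hB', hinj, himg⟩ : ∃ B' ⊆ B, Set.InjOn ρ B' ∧ B'.image ρ = B.image ρ := by
    obtain ⟨B', h1, h2⟩ := Set.exists_subset_bijOn (B : Set Γ) ρ
    lift B' to Finset Γ using B.finite_toSet.subset h1
    refine ⟨B', by exact_mod_cast h1, h2.injOn, ?_⟩
    have := h2.image_eq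
    exact_mod_cast this
  set C := B.image ρ with hCdef
  have hCK : ∀ c ∈ C, c ∈ K := by
    intro c hc
    obtain ⟨b, hb, rfl⟩ := Finset.mem_image.1 hc
    exact hK b hb
  have hCne : C.Nonempty := hB.image ρ
  have hcard : C.card = B'.card := by rw [← himg, Finset.card_image_of_injOn hinj]
  have hgap : κ₀ ≤ kappa C := by
    convert hκ using 1
    unfold repGap
    congr!
  have h1 := norm_sum_koopman_le_kappa C hCK hCne F hF
  have h2 : ∑ c ∈ C, (koopman c F + koopman c⁻¹ F)
      = ∑ b ∈ B', (koopman (ρ b) F + koopman (ρ b)⁻¹ F) := by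
    rw [← himg, Finset.sum_image hinj]
  have h3 := norm_sum_koopman_apply_le (B \ B') ρ
    (fun b hb => hK b (Finset.mem_sdiff.1 hb).1) F
  rw [← Finset.sum_sdiff hB']
  refine (norm_add_le _ _).trans ?_
  rw [h2, hcard] at h1
  have hc : ((B \ B').card : ℝ) = B.card - B'.card := by
    rw [Finset.card_sdiff_of_subset hB', Nat.cast_sub (Finset.card_le_card hB')]
  rw [hc] at h3
  have hc1 : (1 : ℝ) ≤ B'.card := by
    rw [← hcard]; exact_mod_cast hCne.card_pos
  have h4 : 2 * (B'.card : ℝ) * (1 - kappa C) * ‖F‖ ≤ (2 * B'.card - 2 * κ₀) * ‖F‖ := by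
    gcongr
    nlinarith
  linarith

/-! ### Word length -/

/-- The density of `g_* m` is continuous, and so its essential supremum is its maximum. -/
theorem exists_normRN_le (g : SO31) :
    (∀ x, (timeFactor g⁻¹ x)⁻¹ ^ 2 ≤ normRN g) ∧ ∃ x, normRN g ≤ (timeFactor g⁻¹ x)⁻¹ ^ 2 := by
  have hcont : Continuous fun x => (timeFactor g⁻¹ x)⁻¹ ^ 2 :=
    ((continuous_timeFactor g⁻¹).inv₀ fun x => (timeFactor_pos _ x).ne').pow 2
  have hd : Measurable fun x => ENNReal.ofReal ((timeFactor g⁻¹ x)⁻¹ ^ 2) :=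
    hcont.measurable.ennreal_ofReal
  have e : essSup ((m.map fun x => g • x).rnDeriv m) m
      = essSup (fun x => ENNReal.ofReal ((timeFactor g⁻¹ x)⁻¹ ^ 2)) m := by
    rw [map_smul_m]
    exact essSup_congr_ae (Measure.rnDeriv_withDensity m hd)
  have : Nonempty S2 := nonempty_of_isProbabilityMeasure m
  obtain ⟨x₀, -, hx₀⟩ := isCompact_univ.exists_isMaxOn Set.univ_nonempty hcont.continuousOn
  have hmax : ∀ x, (timeFactor g⁻¹ x)⁻¹ ^ 2 ≤ (timeFactor g⁻¹ x₀)⁻¹ ^ 2 := fun x =>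
    hx₀ (Set.mem_univ x)
  have hle : essSup (fun x => ENNReal.ofReal ((timeFactor g⁻¹ x)⁻¹ ^ 2)) m
      ≤ ENNReal.ofReal ((timeFactor g⁻¹ x₀)⁻¹ ^ 2) :=
    essSup_le_of_ae_le _ (Filter.Eventually.of_forall fun x => ENNReal.ofReal_le_ofReal (hmax x))
  unfold normRN
  rw [e]
  refine ⟨?_, x₀, ENNReal.toReal_le_of_le_ofReal (by positivity) hle⟩
  have hae : ∀ᵐ x ∂m, (timeFactor g⁻¹ x)⁻¹ ^ 2 ≤
      (essSup (fun x => ENNReal.ofReal ((timeFactor g⁻¹ x)⁻¹ ^ 2)) m).toReal := by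
    filter_upwards [ENNReal.ae_le_essSup fun x =>
      ENNReal.ofReal ((timeFactor g⁻¹ x)⁻¹ ^ 2)] with x hx
    exact (ENNReal.ofReal_le_iff_le_toReal (hle.trans_lt ENNReal.ofReal_lt_top).ne).1 hx
  have hcl := (isClosed_le hcont continuous_const).closure_eq.symm.trans
    (Measure.dense_of_ae hae).closure_eq
  exact fun x => (Set.ext_iff.1 hcl x).2 (Set.mem_univ x)

section Group

variable {Γ : Type*} [Group Γ]

theorem exists_mem_pow {A : Finset Γ} (hA : Subgroup.closure (A : Set Γ) = ⊤) (γ : Γ) :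
    ∃ n : ℕ, γ ∈ ((A : Set Γ) ∪ (A : Set Γ)⁻¹) ^ n := by
  have hγ : γ ∈ Subgroup.closure (A : Set Γ) := hA ▸ Subgroup.mem_top γ
  induction hγ using Subgroup.closure_induction with
  | mem x hx => exact ⟨1, by rw [pow_one]; exact Or.inl hx⟩
  | one => exact ⟨0, by simp⟩
  | mul x y _ _ hx hy =>
    obtain ⟨a, ha⟩ := hx
    obtain ⟨b, hb⟩ := hy
    exact ⟨a + b, by rw [pow_add]; exact Set.mul_mem_mul ha hb⟩
  | inv x _ hx =>
    obtain ⟨a, ha⟩ := hx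
    refine ⟨a, ?_⟩
    rw [← Set.mem_inv, ← inv_pow, Set.union_inv, inv_inv, Set.union_comm]
    exact ha

theorem mem_pow_wordLength {A : Finset Γ} (hA : Subgroup.closure (A : Set Γ) = ⊤) (γ : Γ) :
    γ ∈ ((A : Set Γ) ∪ (A : Set Γ)⁻¹) ^ wordLength A γ :=
  Nat.sInf_mem (s := {n : ℕ | γ ∈ ((A : Set Γ) ∪ (A : Set Γ)⁻¹) ^ n}) (exists_mem_pow hA γ)

theorem normRN_pos (g : SO31) : 0 < normRN g := by
  obtain ⟨x⟩ : Nonempty S2 := nonempty_of_isProbabilityMeasure m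
  have := timeFactor_pos g⁻¹ x
  exact lt_of_lt_of_le (by positivity) ((exists_normRN_le g).1 x)

theorem finite_generators (A : Finset Γ) : ((A : Set Γ) ∪ (A : Set Γ)⁻¹).Finite :=
  A.finite_toSet.union A.finite_toSet.inv

theorem inv_mem_generators {A : Finset Γ} {a : Γ} (ha : a ∈ (A : Set Γ) ∪ (A : Set Γ)⁻¹) :
    a⁻¹ ∈ (A : Set Γ) ∪ (A : Set Γ)⁻¹ := by
  rcases ha with h | h
  · exact Or.inr (by simpa using h)
  · exact Or.inl h

theorem inv_timeFactor_generator_le (A : Finset Γ) (ρ : Γ →* SO31) {a : Γ}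
    (ha : a ∈ (A : Set Γ) ∪ (A : Set Γ)⁻¹) (x : S2) :
    (timeFactor (ρ a) x)⁻¹ ≤ Real.exp (alpha A ρ / 2) := by
  have h1 : Real.log (normRN (ρ a⁻¹)) ≤ alpha A ρ :=
    le_csSup ((finite_generators A).image _).bddAbove ⟨a⁻¹, inv_mem_generators ha, rfl⟩
  have h2 := (exists_normRN_le (ρ a⁻¹)).1 x
  rw [← map_inv, inv_inv] at h2
  rw [Real.log_le_iff_le_exp (normRN_pos _)] at h1
  have h3 := h2.trans h1
  have h4 : Real.exp (alpha A ρ) = Real.exp (alpha A ρ / 2) ^ 2 := by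
    rw [← Real.exp_nat_mul]; congr 1; push_cast; ring
  rw [h4] at h3
  exact (sq_le_sq₀ (inv_pos.2 (timeFactor_pos _ _)).le (Real.exp_pos _).le).1 h3

theorem timeFactor_generator_le (A : Finset Γ) (ρ : Γ →* SO31) {a : Γ}
    (ha : a ∈ (A : Set Γ) ∪ (A : Set Γ)⁻¹) (x : S2) :
    timeFactor (ρ a) x ≤ Real.exp (alpha A ρ / 2) := by
  have h := inv_timeFactor_generator_le A ρ (inv_mem_generators ha) (ρ a • x)
  rwa [map_inv, timeFactor_inv, inv_smul_smul, inv_inv] at h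

theorem timeFactor_le_of_mem_pow (A : Finset Γ) (ρ : Γ →* SO31) (n : ℕ) :
    ∀ γ ∈ ((A : Set Γ) ∪ (A : Set Γ)⁻¹) ^ n, ∀ x,
      timeFactor (ρ γ) x ≤ Real.exp (alpha A ρ / 2 * n) ∧
      (timeFactor (ρ γ) x)⁻¹ ≤ Real.exp (alpha A ρ / 2 * n) := by
  induction n with
  | zero =>
    intro γ hγ x
    rw [pow_zero, Set.mem_one] at hγ
    simp [hγ, timeFactor_one]
  | succ n ih =>
    intro γ hγ x
    rw [pow_succ] at hγ
    obtain ⟨η, hη, a, ha, rfl⟩ := Set.mem_mul.1 hγ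
    have e : Real.exp (alpha A ρ / 2 * ((n + 1 : ℕ) : ℝ))
        = Real.exp (alpha A ρ / 2 * n) * Real.exp (alpha A ρ / 2) := by
      rw [← Real.exp_add]; congr 1; push_cast; ring
    rw [map_mul, timeFactor_mul, e, mul_inv]
    have h1 := timeFactor_pos (ρ a) x
    obtain ⟨h2, h3⟩ := ih η hη (ρ a • x)
    exact ⟨mul_le_mul h2 (timeFactor_generator_le A ρ ha x) h1.le (Real.exp_pos _).le,
      mul_le_mul h3 (inv_timeFactor_generator_le A ρ ha x) (inv_pos.2 h1).le (Real.exp_pos _).le⟩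

theorem timeFactor_le {A : Finset Γ} (hA : Subgroup.closure (A : Set Γ) = ⊤) (ρ : Γ →* SO31)
    (γ : Γ) (x : S2) : timeFactor (ρ γ) x ≤ Real.exp (alpha A ρ / 2 * wordLength A γ) :=
  (timeFactor_le_of_mem_pow A ρ _ γ (mem_pow_wordLength hA γ) x).1

theorem inv_timeFactor_le {A : Finset Γ} (hA : Subgroup.closure (A : Set Γ) = ⊤) (ρ : Γ →* SO31)
    (γ : Γ) (x : S2) : (timeFactor (ρ γ) x)⁻¹ ≤ Real.exp (alpha A ρ / 2 * wordLength A γ) :=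
  (timeFactor_le_of_mem_pow A ρ _ γ (mem_pow_wordLength hA γ) x).2

/-- The maximum in the definition of `α_ρ` is attained, at a generator and a point of the sphere. -/
theorem exists_generator_alpha (A : Finset Γ) (ρ : Γ →* SO31) (hα : 0 < alpha A ρ) :
    ∃ a ∈ (A : Set Γ) ∪ (A : Set Γ)⁻¹, ∃ x, Real.exp (alpha A ρ / 2) ≤ (timeFactor (ρ a) x)⁻¹ := by
  have hne : ((fun a => Real.log (normRN (ρ a))) '' ((A : Set Γ) ∪ (A : Set Γ)⁻¹)).Nonempty := by
    rw [Set.nonempty_iff_ne_empty]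
    intro h
    rw [alpha, h, Real.sSup_empty] at hα
    exact lt_irrefl _ hα
  obtain ⟨a, ha, hmax⟩ := hne.csSup_mem ((finite_generators A).image _)
  obtain ⟨x, hx⟩ := (exists_normRN_le (ρ a)).2
  refine ⟨a⁻¹, inv_mem_generators ha, x, ?_⟩
  change Real.log (normRN (ρ a)) = alpha A ρ at hmax
  have h1 : Real.exp (alpha A ρ) = normRN (ρ a) := by rw [← hmax, Real.exp_log (normRN_pos _)]
  have h4 : Real.exp (alpha A ρ) = Real.exp (alpha A ρ / 2) ^ 2 := by
    rw [← Real.exp_nat_mul]; congr 1; push_cast; ring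
  rw [← h1, h4, ← map_inv] at hx
  exact (sq_le_sq₀ (Real.exp_pos _).le (inv_pos.2 (timeFactor_pos _ _)).le).1 hx

end Group

/-! ### Averages of powers of a weighted sum of operators -/

section Abstract

variable {Γ : Type*} [Group Γ]

/-- The multiplicative induction behind `exists_pow_sub_smul_le`. The bound `v'` for `V_b` is the
product of the bounds along a word for `b`; with `δ v'` in place of `δ ‖V_b‖` the bounds multiply
exactly. -/
theorem exists_pow_sub_smul_le_aux {𝒜 : Type*} [NormedRing 𝒜] [NormedAlgebra ℝ 𝒜]
    (h𝒜 : ‖(1 : 𝒜)‖ ≤ 1) (p : Γ → ℝ) {b : Γ}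
    (hb : b ∈ Submonoid.closure {γ | 0 < p γ}) :
    ∃ (n : ℕ) (δ : ℝ), 0 < δ ∧ ∀ (V : Γ → 𝒜) (v : Γ → ℝ) (T : 𝒜) (s : ℝ), V 1 = 1 →
      (∀ γ η, V (γ * η) = V η * V γ) → (∀ γ, ‖V γ‖ ≤ v γ) → (∀ γ, 1 ≤ v γ) →
      (∀ γ, 0 ≤ p γ) →
      HasSum (fun γ => p γ • V γ) T → HasSum (fun γ => p γ * v γ) s →
      ∃ v', 1 ≤ v' ∧ ‖V b‖ ≤ v' ∧ ‖T ^ n‖ ≤ s ^ n ∧ ‖T ^ n - δ • V b‖ ≤ s ^ n - δ * v' := by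
  classical
  induction hb using Submonoid.closure_induction_left with
  | one =>
    refine ⟨0, 1, one_pos, fun V v T s hV1 _ _ _ _ _ _ => ⟨1, le_rfl, ?_, ?_, ?_⟩⟩
    · rwa [hV1]
    · simpa using h𝒜
    · simp [hV1]
  | mul_left γ hγ x hx ih =>
    obtain ⟨n, δ, hδ, ih⟩ := ih
    have hγ' : 0 < p γ := hγ
    refine ⟨n + 1, δ * p γ, mul_pos hδ hγ', fun V v T s hV1 hV hv hv1 hp hT hs => ?_⟩
    obtain ⟨v', hv', hVx, hTn, hTx⟩ := ih V v T s hV1 hV hv hv1 hp hT hs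
    have hnorm : ∀ γ, ‖p γ • V γ‖ ≤ p γ * v γ := fun γ => by
      rw [norm_smul, Real.norm_of_nonneg (hp γ)]
      exact mul_le_mul_of_nonneg_left (hv γ) (hp γ)
    have hT1 : ‖T‖ ≤ s := hT.norm_le_of_bounded hs hnorm
    -- removing the term of `γ` from the sum defining `T`
    have hT2 : ‖T - p γ • V γ‖ ≤ s - p γ * v γ := by
      have h1 := hT.update γ 0
      have h2 := hs.update γ 0
      rw [zero_sub, neg_add_eq_sub] at h1 h2
      refine h1.norm_le_of_bounded h2 fun η => ?_
      rcases eq_or_ne η γ with rfl | h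
      · simp
      · simpa [Function.update_of_ne h] using hnorm η
    have hs0 : 0 ≤ s := (norm_nonneg _).trans hT1
    refine ⟨v' * v γ, one_le_mul_of_one_le_of_one_le hv' (hv1 γ), ?_, ?_, ?_⟩
    · rw [hV]
      exact (norm_mul_le _ _).trans (mul_le_mul hVx (hv γ) (norm_nonneg _) (by linarith))
    · rw [pow_succ, pow_succ]
      exact (norm_mul_le _ _).trans (mul_le_mul hTn hT1 (norm_nonneg _) (by positivity))
    · have e : T ^ (n + 1) - (δ * p γ) • V (γ * x)
          = (T ^ n - δ • V x) * (p γ • V γ) + T ^ n * (T - p γ • V γ) := by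
        rw [hV, pow_succ, sub_mul, mul_sub, smul_mul_smul_comm]
        abel
      rw [e]
      calc _ ≤ ‖T ^ n - δ • V x‖ * ‖p γ • V γ‖ + ‖T ^ n‖ * ‖T - p γ • V γ‖ :=
            (norm_add_le _ _).trans (add_le_add (norm_mul_le _ _) (norm_mul_le _ _))
        _ ≤ (s ^ n - δ * v') * (p γ * v γ) + s ^ n * (s - p γ * v γ) := by
            gcongr
            · exact (norm_nonneg _).trans hTx
            · exact hnorm γ
        _ = _ := by ring

/-- If `T = ∑ p(γ) V_γ` and `s = ∑ p(γ) v(γ)`, with `‖V_γ‖ ≤ v(γ)`, and `b` is a product of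
elements of the support of `p`, then a power `T ^ n` contains a multiple `δ V_b`, and the rest has
norm at most `s ^ n - δ`. The numbers `n` and `δ` depend only on `p` and `b`. -/
theorem exists_pow_sub_smul_le (𝒜 : Type*) [NormedRing 𝒜] [NormedAlgebra ℝ 𝒜]
    (h𝒜 : ‖(1 : 𝒜)‖ ≤ 1) (p : Γ → ℝ) (hp : ∀ γ, 0 ≤ p γ) {b : Γ}
    (hb : b ∈ Submonoid.closure {γ | 0 < p γ}) :
    ∃ (n : ℕ) (δ : ℝ), 0 < δ ∧ ∀ δ' ≤ δ, ∀ (V : Γ → 𝒜) (v : Γ → ℝ) (T : 𝒜) (s : ℝ), V 1 = 1 →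
      (∀ γ η, V (γ * η) = V η * V γ) → (∀ γ, ‖V γ‖ ≤ v γ) → (∀ γ, 1 ≤ v γ) →
      HasSum (fun γ => p γ • V γ) T → HasSum (fun γ => p γ * v γ) s → ‖V b‖ ≤ 1 →
      ‖T ^ n - δ' • V b‖ ≤ s ^ n - δ' := by
  obtain ⟨n, δ, hδ, h⟩ := exists_pow_sub_smul_le_aux (𝒜 := 𝒜) h𝒜 p hb
  refine ⟨n, δ, hδ, fun δ' hδ' V v T s hV1 hV hv hv1 hT hs hVb => ?_⟩
  obtain ⟨v', hv', -, -, hle⟩ := h V v T s hV1 hV hv hv1 hp hT hs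
  have e : T ^ n - δ' • V b = (T ^ n - δ • V b) + (δ - δ') • V b := by
    rw [sub_smul]; abel
  have h1 : ‖(δ - δ') • V b‖ ≤ (δ - δ') * 1 := by
    rw [norm_smul, Real.norm_of_nonneg (by linarith)]
    exact mul_le_mul_of_nonneg_left hVb (by linarith)
  rw [e]
  refine (norm_add_le _ _).trans ?_
  nlinarith

/-- The average over `b ∈ B` of the powers `T ^ n(b)` and `T ^ n(b⁻¹)`. -/
def avgPow {R : Type*} [Ring R] [Algebra ℝ R] (B : Finset Γ) (n : Γ → ℕ) (T : R) : R :=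
  (2 * (B.card : ℝ))⁻¹ • ∑ b ∈ B, (T ^ n b + T ^ n b⁻¹)

theorem commute_avgPow {R : Type*} [Ring R] [Algebra ℝ R] (B : Finset Γ) (n : Γ → ℕ) (T : R) :
    Commute T (avgPow B n T) :=
  (Commute.sum_right _ _ _ fun _ _ =>
    (Commute.self_pow T _).add_right (Commute.self_pow T _)).smul_right _

variable {E F : Type*} [NormedAddCommGroup E] [NormedSpace ℝ E]
  [NormedAddCommGroup F] [NormedSpace ℝ F]

theorem avgPow_apply (B : Finset Γ) (n : Γ → ℕ) (T : E →L[ℝ] E) (x : E) :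
    avgPow B n T x = (2 * (B.card : ℝ))⁻¹ • ∑ b ∈ B, ((T ^ n b) x + (T ^ n b⁻¹) x) := by
  simp [avgPow]

theorem pow_intertwine {T : E →L[ℝ] E} {S : F →L[ℝ] F} {i : E →L[ℝ] F}
    (h : ∀ x, S (i x) = i (T x)) (k : ℕ) (x : E) : (S ^ k) (i x) = i ((T ^ k) x) := by
  induction k generalizing x with
  | zero => rfl
  | succ k ih => rw [pow_succ, pow_succ, mul_apply_eq_comp, mul_apply_eq_comp, h, ih]

theorem avgPow_intertwine (B : Finset Γ) (n : Γ → ℕ) {T : E →L[ℝ] E} {S : F →L[ℝ] F}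
    {i : E →L[ℝ] F} (h : ∀ x, S (i x) = i (T x)) (x : E) :
    avgPow B n S (i x) = i (avgPow B n T x) := by
  simp [avgPow_apply, pow_intertwine h]

theorem pow_apply_eq_self {T : E →L[ℝ] E} {e : E} (h : T e = e) (k : ℕ) : (T ^ k) e = e := by
  induction k with
  | zero => rfl
  | succ k ih => rw [pow_succ, mul_apply_eq_comp, h, ih]

theorem avgPow_apply_eq_self {B : Finset Γ} (hB : B.Nonempty) (n : Γ → ℕ) {T : E →L[ℝ] E} {e : E}
    (h : T e = e) : avgPow B n T e = e := by
  have : (B.card : ℝ) ≠ 0 := by exact_mod_cast hB.card_pos.ne'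
  simp only [avgPow_apply, pow_apply_eq_self h, Finset.sum_const, ← two_smul ℝ e,
    ← Nat.cast_smul_eq_nsmul ℝ, smul_smul]
  rw [show (2 * (B.card : ℝ))⁻¹ * ((B.card : ℝ) * 2) = 1 by field_simp, one_smul]

/-- Here `P a x` reads: the vector `x` is bounded by `a`. If `T` multiplies bounds by at most `s`,
then an average of its powers multiplies them by at most a bound `σ` for the powers of `s`.
Examples are Lipschitz constants, and positivity, for which `P` does not depend on `a`. -/
theorem avgPow_mem {P : ℝ → E → Prop} (hadd : ∀ a b x y, P a x → P b y → P (a + b) (x + y))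
    (hsmul : ∀ c a x, 0 ≤ c → P a x → P (c * a) (c • x)) (hzero : P 0 0)
    (hmono : ∀ a b x, a ≤ b → P a x → P b x) {B : Finset Γ} (hB : B.Nonempty) (n : Γ → ℕ)
    {T : E →L[ℝ] E} {s σ : ℝ} (hs : 0 ≤ s) (hT : ∀ a x, 0 ≤ a → P a x → P (s * a) (T x))
    (hσ : ∀ b ∈ B, s ^ n b ≤ σ ∧ s ^ n b⁻¹ ≤ σ) {a : ℝ} {x : E} (ha : 0 ≤ a) (hx : P a x) :
    P (σ * a) (avgPow B n T x) := by
  have hpow : ∀ k : ℕ, P (s ^ k * a) ((T ^ k) x) := by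
    intro k
    induction k with
    | zero => simpa using hx
    | succ k ih =>
      rw [pow_succ', pow_succ', mul_apply_eq_comp, mul_assoc]
      exact hT _ _ (by positivity) ih
  have hsum : ∀ B' ⊆ B, P (B'.card * (2 * (σ * a))) (∑ b ∈ B', ((T ^ n b) x + (T ^ n b⁻¹) x)) := by
    classical
    intro B'
    induction B' using Finset.induction_on with
    | empty => intro _; simpa using hzero
    | insert b B' hb ih =>
      intro hsub
      rw [Finset.sum_insert hb, Finset.card_insert_of_notMem hb]
      have hbB := hσ b (hsub (Finset.mem_insert_self b B'))
      have h1 := hadd _ _ _ _ (hpow (n b)) (hpow (n b⁻¹))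
      have h2 := ih fun c hc => hsub (Finset.mem_insert_of_mem hc)
      refine hmono _ _ _ ?_ (hadd _ _ _ _ h1 h2)
      have h3 := mul_le_mul_of_nonneg_right hbB.1 ha
      have h4 := mul_le_mul_of_nonneg_right hbB.2 ha
      push_cast
      linarith
  have hc : (B.card : ℝ) ≠ 0 := by exact_mod_cast hB.card_pos.ne'
  rw [avgPow_apply]
  have h := hsmul (2 * (B.card : ℝ))⁻¹ _ _ (by positivity) (hsum B subset_rfl)
  refine hmono _ _ _ (le_of_eq ?_) h
  field_simp

/-- The average of powers contracts as soon as the operators `V_b`, `b ∈ B`, have a spectral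
gap. -/
theorem norm_avgPow_le {B : Finset Γ} (hB : B.Nonempty) (n : Γ → ℕ) (T : E →L[ℝ] E)
    (V : Γ → E →L[ℝ] E) {s σ δ κ : ℝ} (hδ : 0 ≤ δ)
    (hT : ∀ b ∈ B, ‖T ^ n b - δ • V b‖ ≤ s ^ n b - δ ∧ ‖T ^ n b⁻¹ - δ • V b⁻¹‖ ≤ s ^ n b⁻¹ - δ)
    (hσ : ∀ b ∈ B, s ^ n b ≤ σ ∧ s ^ n b⁻¹ ≤ σ) {x : E}
    (hx : ‖∑ b ∈ B, (V b x + V b⁻¹ x)‖ ≤ (2 * B.card - 2 * κ) * ‖x‖) :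
    ‖avgPow B n T x‖ ≤ (σ - δ * κ / B.card) * ‖x‖ := by
  have hc : (0 : ℝ) < B.card := by exact_mod_cast hB.card_pos
  have e : ∑ b ∈ B, ((T ^ n b) x + (T ^ n b⁻¹) x) = δ • ∑ b ∈ B, (V b x + V b⁻¹ x) +
      ∑ b ∈ B, ((T ^ n b - δ • V b) x + (T ^ n b⁻¹ - δ • V b⁻¹) x) := by
    rw [Finset.smul_sum, ← Finset.sum_add_distrib]
    refine Finset.sum_congr rfl fun b _ => ?_
    simp only [sub_apply, smul_apply, smul_add]
    abel
  have h1 : ‖∑ b ∈ B, ((T ^ n b - δ • V b) x + (T ^ n b⁻¹ - δ • V b⁻¹) x)‖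
      ≤ B.card * (2 * (σ - δ) * ‖x‖) := by
    refine (norm_sum_le_of_le B (fun b hb => ?_ : ∀ b ∈ B, _ ≤ 2 * (σ - δ) * ‖x‖)).trans ?_
    · refine (norm_add_le _ _).trans ?_
      have h2 := (T ^ n b - δ • V b).le_of_opNorm_le ((hT b hb).1.trans
        (sub_le_sub_right (hσ b hb).1 δ)) x
      have h3 := (T ^ n b⁻¹ - δ • V b⁻¹).le_of_opNorm_le ((hT b hb).2.trans
        (sub_le_sub_right (hσ b hb).2 δ)) x
      linarith
    · rw [Finset.sum_const, nsmul_eq_mul]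
  rw [avgPow_apply, norm_smul, Real.norm_of_nonneg (by positivity), inv_mul_le_iff₀ (by positivity),
    e]
  refine (norm_add_le _ _).trans ?_
  rw [norm_smul, Real.norm_of_nonneg hδ]
  calc _ ≤ δ * ((2 * B.card - 2 * κ) * ‖x‖) + B.card * (2 * (σ - δ) * ‖x‖) := by gcongr
    _ = _ := by field_simp; ring

end Abstract

/-! ### A fixed vector of the adjoint operator -/

section Hilbert

open Filter Topology

variable {E : Type*} [NormedAddCommGroup E] [InnerProductSpace ℝ E] [CompleteSpace E]

/-- If `Q` fixes the unit vector `e` and contracts its orthogonal complement, then the adjoint of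
any operator which fixes `e` and commutes with `Q` has a fixed vector `φ` with `⟨e, φ⟩ = 1`. The
last clause holds because `φ` is the limit of `(Q†)^k e`; it yields positivity of `φ` when `Q` is
positive. -/
theorem exists_adjoint_fixed {T Q : E →L[ℝ] E} {e : E} (he : ‖e‖ = 1) (hTe : T e = e)
    (hQe : Q e = e) (hTQ : Commute T Q) {q : ℝ} (hq0 : 0 ≤ q) (hq : q < 1)
    (hQ : ∀ f, inner ℝ e f = 0 → ‖Q f‖ ≤ q * ‖f‖) :
    ∃ φ : E, inner ℝ e φ = 1 ∧ (∀ f, inner ℝ φ (T f) = inner ℝ φ f) ∧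
      ∀ f, (∀ k : ℕ, 0 ≤ inner ℝ e ((Q ^ k) f)) → 0 ≤ inner ℝ φ f := by
  set S := ContinuousLinearMap.adjoint Q with hS
  have hSe : ∀ ψ, inner ℝ e (S ψ) = inner ℝ e ψ := fun ψ => by
    rw [real_inner_comm, hS, ContinuousLinearMap.adjoint_inner_left, hQe, real_inner_comm]
  have hSq : ∀ ψ, inner ℝ e ψ = 0 → ‖S ψ‖ ≤ q * ‖ψ‖ := by
    intro ψ hψ
    have h1 : inner ℝ e (S ψ) = 0 := by rw [hSe, hψ]
    have h2 : ‖S ψ‖ ^ 2 ≤ ‖ψ‖ * (q * ‖S ψ‖) := by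
      rw [← real_inner_self_eq_norm_sq]
      nth_rewrite 1 [hS]
      rw [ContinuousLinearMap.adjoint_inner_left]
      exact (real_inner_le_norm _ _).trans (mul_le_mul_of_nonneg_left (hQ _ h1) (norm_nonneg _))
    rcases (norm_nonneg (S ψ)).eq_or_lt with h | h
    · rw [← h]; positivity
    · nlinarith
  have hpow : ∀ k ψ f, inner ℝ ((S ^ k) ψ) f = inner ℝ ψ ((Q ^ k) f) := by
    intro k
    induction k with
    | zero => intro ψ f; rfl
    | succ k ih =>
      intro ψ f
      rw [pow_succ', pow_succ, mul_apply_eq_comp, mul_apply_eq_comp, hS,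
        ContinuousLinearMap.adjoint_inner_left, ← hS, ih]
  have hgeo : ∀ k ψ, inner ℝ e ψ = 0 → ‖(S ^ k) ψ‖ ≤ q ^ k * ‖ψ‖ ∧ inner ℝ e ((S ^ k) ψ) = 0 := by
    intro k ψ hψ
    induction k with
    | zero => simp [hψ]
    | succ k ih =>
      rw [pow_succ', mul_apply_eq_comp, hSe]
      refine ⟨(hSq _ ih.2).trans ?_, ih.2⟩
      rw [pow_succ', mul_assoc]
      exact mul_le_mul_of_nonneg_left ih.1 hq0
  have hcauchy : CauchySeq fun k => (S ^ k) e := by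
    refine cauchySeq_of_le_geometric q ‖e - S e‖ hq fun k => ?_
    rw [dist_eq_norm, pow_succ, mul_apply_eq_comp, ← map_sub, mul_comm]
    refine (hgeo k _ ?_).1
    rw [inner_sub_right, hSe, sub_self]
  obtain ⟨φ, hφ⟩ := cauchySeq_tendsto_of_complete hcauchy
  have hSφ : S φ = φ := by
    refine tendsto_nhds_unique ?_ ((tendsto_add_atTop_iff_nat 1).2 hφ)
    have := (S.continuous.tendsto φ).comp hφ
    refine this.congr fun k => ?_
    rw [Function.comp_apply, pow_succ', mul_apply_eq_comp]
  have hinner : ∀ f, Tendsto (fun k : ℕ => inner ℝ e ((Q ^ k) f)) atTop (𝓝 (inner ℝ φ f)) := by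
    intro f
    refine (hφ.inner (tendsto_const_nhds (x := f))).congr fun k => ?_
    exact hpow k e f
  have hφe : inner ℝ e φ = 1 := by
    rw [real_inner_comm]
    refine tendsto_nhds_unique (hinner e) ?_
    simp only [pow_apply_eq_self hQe, real_inner_self_eq_norm_sq, he]
    simp
  refine ⟨φ, hφe, ?_, fun f hf => ge_of_tendsto' (hinner f) hf⟩
  -- `T† φ - φ` is fixed by `S` and orthogonal to `e`, hence zero
  set R := ContinuousLinearMap.adjoint T with hR
  have hcomm : S (R φ) = R (S φ) := by
    refine ext_inner_right ℝ fun f => ?_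
    rw [hS, hR, ContinuousLinearMap.adjoint_inner_left, ContinuousLinearMap.adjoint_inner_left,
      ContinuousLinearMap.adjoint_inner_left, ContinuousLinearMap.adjoint_inner_left,
      ← mul_apply_eq_comp, ← mul_apply_eq_comp, hTQ.eq]
  have h0 : inner ℝ e (R φ - φ) = 0 := by
    rw [inner_sub_right, real_inner_comm, hR, ContinuousLinearMap.adjoint_inner_left, hTe,
      real_inner_comm, sub_self]
  have h1 : S (R φ - φ) = R φ - φ := by rw [map_sub, hcomm, hSφ]
  have h2 := hSq _ h0
  rw [h1] at h2
  have h3 : R φ - φ = 0 := by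
    rw [← norm_eq_zero]
    nlinarith [norm_nonneg (R φ - φ)]
  intro f
  rw [← ContinuousLinearMap.adjoint_inner_left, ← hR, sub_eq_zero.1 h3]

end Hilbert

/-! ### The Markov operator -/

section Markov

open Filter Topology

theorem hasSum_toReal_pmf {Γ : Type*} (μ : PMF Γ) : HasSum (fun γ => (μ γ).toReal) 1 := by
  have h := ENNReal.hasSum_toReal (f := fun γ => μ γ) (by rw [μ.tsum_coe]; simp)
  rwa [← ENNReal.tsum_toReal_eq μ.apply_ne_top, μ.tsum_coe, ENNReal.toReal_one] at h

theorem summable_smul_of_norm_le_one {Γ E : Type*} [NormedAddCommGroup E] [NormedSpace ℝ E]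
    [CompleteSpace E] (μ : PMF Γ) {U : Γ → E →L[ℝ] E} (hU : ∀ γ, ‖U γ‖ ≤ 1) :
    Summable fun γ => (μ γ).toReal • U γ := by
  refine Summable.of_norm_bounded (hasSum_toReal_pmf μ).summable fun γ => ?_
  rw [norm_smul, Real.norm_of_nonneg ENNReal.toReal_nonneg]
  exact mul_le_of_le_one_right ENNReal.toReal_nonneg (hU γ)

variable {Γ : Type*} [Group Γ]

/-- An exponential moment is close to `1` when the exponent is small, by convexity of `exp`. -/
theorem exists_expSum_le {A : Finset Γ} {μ : PMF Γ} (hexp : HasFiniteExpMoment A μ) :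
    ∃ c : ℝ, 0 < c ∧ ∀ α : ℝ, 0 ≤ α → α * c ≤ 1 →
      ∃ s, HasSum (fun γ => (μ γ).toReal * Real.exp (α / 2 * wordLength A γ)) s ∧
        1 ≤ s ∧ s ≤ 1 + α * c := by
  obtain ⟨ε, hε, hsum⟩ := hexp
  obtain ⟨M, hM⟩ := hsum
  have hp := hasSum_toReal_pmf μ
  have hM1 : 1 ≤ M := by
    refine hasSum_le (fun γ => ?_) hp hM
    exact le_mul_of_one_le_right ENNReal.toReal_nonneg (Real.one_le_exp (by positivity))
  refine ⟨(M / (2 * ε)), by positivity, fun α hα hα1 => ?_⟩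
  have hθ : α / (2 * ε) ≤ 1 := by
    refine le_trans ?_ hα1
    rw [mul_div_assoc']
    gcongr
    exact le_mul_of_one_le_right hα hM1
  set θ := α / (2 * ε) with hθdef
  have hθ0 : 0 ≤ θ := by positivity
  have hconv : ∀ x : ℝ, Real.exp (θ * x) ≤ 1 + θ * (Real.exp x - 1) := by
    intro x
    have h := convexOn_exp.2 (Set.mem_univ 0) (Set.mem_univ x) (sub_nonneg.2 hθ) hθ0
      (sub_add_cancel 1 θ)
    simp only [smul_eq_mul, mul_zero, zero_add, Real.exp_zero, mul_one] at h
    linarith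
  have hle : ∀ γ, (μ γ).toReal * Real.exp (α / 2 * wordLength A γ) ≤
      (μ γ).toReal * (1 - θ) + θ * ((μ γ).toReal * Real.exp (ε * wordLength A γ)) := by
    intro γ
    have h1 := hconv (ε * wordLength A γ)
    have e : θ * (ε * wordLength A γ) = α / 2 * wordLength A γ := by
      rw [hθdef]; field_simp
    rw [e] at h1
    have := mul_le_mul_of_nonneg_left h1 (ENNReal.toReal_nonneg (a := μ γ))
    linarith
  have hbd := (hp.mul_right (1 - θ)).add (hM.mul_left θ)
  have hs : Summable fun γ => (μ γ).toReal * Real.exp (α / 2 * wordLength A γ) :=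
    Summable.of_nonneg_of_le (fun γ => by positivity) hle hbd.summable
  refine ⟨_, hs.hasSum, ?_, ?_⟩
  · refine hasSum_le (fun γ => ?_) hp hs.hasSum
    exact le_mul_of_one_le_right ENNReal.toReal_nonneg (Real.one_le_exp (by positivity))
  · have := hasSum_le hle hs.hasSum hbd
    have e : α * (M / (2 * ε)) = θ * M := by rw [hθdef]; ring
    rw [e]
    linarith

/-- The Markov operator `f ↦ ∑ μ(γ) f ∘ γ` on `L²(S², m)`. -/
def markovH (μ : PMF Γ) (ρ : Γ →* SO31) : H →L[ℝ] H :=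
  ∑' γ, (μ γ).toReal • koopman (ρ γ)

/-- The Markov operator `f ↦ ∑ μ(γ) f ∘ γ` on the continuous functions. -/
def markovC (μ : PMF Γ) (ρ : Γ →* SO31) : C(S2, ℝ) →L[ℝ] C(S2, ℝ) :=
  ∑' γ, (μ γ).toReal • compC (ρ γ)

theorem hasSum_markovC (μ : PMF Γ) (ρ : Γ →* SO31) :
    HasSum (fun γ => (μ γ).toReal • compC (ρ γ)) (markovC μ ρ) := by
  exact (summable_smul_of_norm_le_one μ fun γ => norm_compC_le (ρ γ)).hasSum

theorem hasSum_markovC_apply (μ : PMF Γ) (ρ : Γ →* SO31) (f : C(S2, ℝ)) :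
    HasSum (fun γ => (μ γ).toReal • compC (ρ γ) f) (markovC μ ρ f) :=
  (hasSum_markovC μ ρ).mapL (ContinuousLinearMap.apply ℝ C(S2, ℝ) f)

theorem hasSum_markovC_apply_apply (μ : PMF Γ) (ρ : Γ →* SO31) (f : C(S2, ℝ)) (x : S2) :
    HasSum (fun γ => (μ γ).toReal * f (ρ γ • x)) (markovC μ ρ f x) := by
  have h := ContinuousMap.hasSum_apply (hasSum_markovC_apply μ ρ f) x
  simpa only [ContinuousMap.smul_apply, compC_apply, smul_eq_mul] using h

variable {A : Finset Γ} {μ : PMF Γ} {ρ : Γ →* SO31}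

theorem hasSum_markovH (hA : Subgroup.closure (A : Set Γ) = ⊤)
    (hs : Summable fun γ => (μ γ).toReal * Real.exp (alpha A ρ / 2 * wordLength A γ)) :
    HasSum (fun γ => (μ γ).toReal • koopman (ρ γ)) (markovH μ ρ) := by
  refine (Summable.of_norm_bounded hs fun γ => ?_).hasSum
  rw [norm_smul, Real.norm_of_nonneg ENNReal.toReal_nonneg]
  exact mul_le_mul_of_nonneg_left (norm_koopman_le fun x => timeFactor_le hA ρ γ x)
    ENNReal.toReal_nonneg

theorem markovH_toH (h : HasSum (fun γ => (μ γ).toReal • koopman (ρ γ)) (markovH μ ρ))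
    (f : C(S2, ℝ)) : markovH μ ρ (toH f) = toH (markovC μ ρ f) := by
  have h1 := h.mapL (ContinuousLinearMap.apply ℝ H (toH f))
  have h2 := (hasSum_markovC_apply μ ρ f).mapL toH
  refine h1.unique (h2.congr_fun fun γ => ?_)
  rw [ContinuousLinearMap.apply_apply, smul_apply, koopman_toH, map_smul]

theorem markovC_one : markovC μ ρ 1 = 1 := by
  ext x
  refine (hasSum_markovC_apply_apply μ ρ 1 x).unique ?_
  simpa using hasSum_toReal_pmf μ

/-- A Lipschitz bound for a function on the sphere. -/
def LipBound (l : ℝ) (f : C(S2, ℝ)) : Prop := ∀ y z, |f y - f z| ≤ l * dist y z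

theorem markovC_lipBound (hA : Subgroup.closure (A : Set Γ) = ⊤) {s : ℝ}
    (hs : HasSum (fun γ => (μ γ).toReal * Real.exp (alpha A ρ / 2 * wordLength A γ)) s)
    {l : ℝ} (hl : 0 ≤ l) {f : C(S2, ℝ)} (hf : LipBound l f) :
    LipBound (s * l) (markovC μ ρ f) := by
  intro y z
  have h := (hasSum_markovC_apply_apply μ ρ f y).sub (hasSum_markovC_apply_apply μ ρ f z)
  rw [← Real.norm_eq_abs]
  have hb := hs.mul_right (l * dist y z)
  rw [mul_assoc]
  refine h.norm_le_of_bounded hb fun γ => ?_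
  rw [← mul_sub, norm_mul, Real.norm_of_nonneg ENNReal.toReal_nonneg, mul_assoc, Real.norm_eq_abs]
  refine mul_le_mul_of_nonneg_left ?_ ENNReal.toReal_nonneg
  refine (hf _ _).trans ?_
  rw [mul_left_comm]
  exact mul_le_mul_of_nonneg_left (dist_smul_le (fun x => inv_timeFactor_le hA ρ γ x) y z) hl

theorem markovH_nonneg (h : HasSum (fun γ => (μ γ).toReal • koopman (ρ γ)) (markovH μ ρ))
    {f : H} (hf : 0 ≤ f) : 0 ≤ markovH μ ρ f := by
  refine HasSum.nonneg (fun γ => ?_) (h.mapL (ContinuousLinearMap.apply ℝ H f))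
  rw [ContinuousLinearMap.apply_apply, smul_apply, ← Lp.coeFn_nonneg]
  filter_upwards [Lp.coeFn_smul (μ γ).toReal (koopman (ρ γ) f), coeFn_wcomp (ρ γ) 1 f,
    (quasiMeasurePreserving_smul (ρ γ)).ae ((Lp.coeFn_nonneg f).2 hf)] with x h1 h2 h3
  rw [h1, Pi.smul_apply, koopman, h2]
  simp only [ContinuousMap.one_apply, one_mul, smul_eq_mul]
  exact mul_nonneg ENNReal.toReal_nonneg h3

/-- For representations with a spectral gap on `B` and small `α_ρ`, a fixed average `Q` of powers of
the Markov operator contracts the functions of mean zero in `L²`, and hardly increases Lipschitz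
constants. The exponents in `σ ^ 3 * q ^ 2 < 1` are those of `exists_lipschitz_bound`. -/
theorem exists_contraction (A : Finset Γ) (hA : Subgroup.closure (A : Set Γ) = ⊤) (B : Finset Γ)
    (hB : B.Nonempty) (μ : PMF Γ) (hgen : GeneratesAsSemigroup μ) (hexp : HasFiniteExpMoment A μ)
    (κ₀ : ℝ) (hκ₀ : 0 < κ₀) :
    ∃ (n : Γ → ℕ) (q σ α₁ : ℝ), 0 ≤ q ∧ q < 1 ∧ 1 ≤ σ ∧ σ ^ 3 * q ^ 2 < 1 ∧ 0 < α₁ ∧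
      ∀ ρ : Γ →* SO31, (∀ b ∈ B, ρ b ∈ K) → κ₀ ≤ repGap B ρ → 0 ≤ alpha A ρ → alpha A ρ ≤ α₁ →
        HasSum (fun γ => (μ γ).toReal • koopman (ρ γ)) (markovH μ ρ) ∧
        (∀ f, inner ℝ (toH 1) f = 0 → ‖avgPow B n (markovH μ ρ) f‖ ≤ q * ‖f‖) ∧
        ∀ (f : C(S2, ℝ)) (l : ℝ), 0 ≤ l → LipBound l f →
          LipBound (σ * l) (avgPow B n (markovC μ ρ) f) := by
  classical
  have hsupp : ∀ b : Γ, b ∈ Submonoid.closure {γ | 0 < (μ γ).toReal} := by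
    intro b
    have e : {γ | 0 < (μ γ).toReal} = μ.support := by
      ext γ
      simp [ENNReal.toReal_pos_iff, pos_iff_ne_zero, μ.apply_lt_top γ]
    rw [e, show Submonoid.closure μ.support = ⊤ from hgen]
    trivial
  have hpow := fun b : Γ => exists_pow_sub_smul_le (H →L[ℝ] H) ContinuousLinearMap.norm_id_le
    (fun γ => (μ γ).toReal) (fun γ => ENNReal.toReal_nonneg) (hsupp b)
  choose n δ hδ hpow using hpow
  -- a common weight for all elements of `B` and their inverses
  obtain ⟨δ₀, hδ₀, hδB⟩ : ∃ δ₀ : ℝ, 0 < δ₀ ∧ ∀ b ∈ B, δ₀ ≤ δ b ∧ δ₀ ≤ δ b⁻¹ := by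
    refine ⟨B.inf' hB fun b => min (δ b) (δ b⁻¹), ?_, fun b hb => ?_⟩
    · rw [Finset.lt_inf'_iff]
      exact fun b _ => lt_min (hδ b) (hδ b⁻¹)
    · exact le_min_iff.1 (Finset.inf'_le (fun b => min (δ b) (δ b⁻¹)) hb)
  obtain ⟨N, hN⟩ : ∃ N : ℕ, ∀ b ∈ B, n b ≤ N ∧ n b⁻¹ ≤ N :=
    ⟨B.sup fun b => max (n b) (n b⁻¹), fun b hb =>
      max_le_iff.1 (Finset.le_sup (f := fun b => max (n b) (n b⁻¹)) hb)⟩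
  have hcard : (0 : ℝ) < B.card := by exact_mod_cast hB.card_pos
  -- the gain from the gap; when the powers of `s` are at most `σ = 1 + d / 4`, a quarter of it is
  -- lost, and the contraction is by `q = σ - d = 1 - 3 d / 4`
  set d : ℝ := min 1 (δ₀ * κ₀ / B.card) with hd
  have hd0 : 0 < d := lt_min one_pos (by positivity)
  have hd1 : d ≤ 1 := min_le_left _ _
  obtain ⟨η, hη, hηN⟩ : ∃ η : ℝ, 0 < η ∧ (1 + η) ^ N ≤ 1 + d / 4 := by
    have hc : Tendsto (fun η : ℝ => (1 + η) ^ N) (𝓝[>] 0) (𝓝 1) := by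
      have : Continuous fun η : ℝ => (1 + η) ^ N := by fun_prop
      simpa using this.continuousWithinAt.tendsto (x := (0 : ℝ)) (s := Set.Ioi 0)
    have h1 := hc.eventually_le_const (show (1 : ℝ) < 1 + d / 4 by linarith)
    obtain ⟨η, h2, h3⟩ := (h1.and self_mem_nhdsWithin).exists
    exact ⟨η, h3, h2⟩
  obtain ⟨c, hc, hexpSum⟩ := exists_expSum_le hexp
  refine ⟨n, 1 - 3 * d / 4, 1 + d / 4, min 1 η / c, by linarith, by linarith, by linarith, ?_,
    by positivity, fun ρ hK hgap hα0 hα => ?_⟩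
  · have h1 : (1 + d / 4) ^ 3 * (1 - 3 * d / 4) ^ 2
        ≤ ((1 + d / 4) ^ 2 * (1 - 3 * d / 4)) ^ 2 := by
      rw [mul_pow, ← pow_mul]
      gcongr
      · linarith
      · norm_num
    have h2 : (1 + d / 4) ^ 2 * (1 - 3 * d / 4) < 1 := by
      nlinarith [mul_pos hd0 hd0, mul_pos hd0 (mul_pos hd0 hd0)]
    refine h1.trans_lt (pow_lt_one₀ ?_ h2 two_ne_zero)
    exact mul_nonneg (by positivity) (by linarith)
  have hαc : alpha A ρ * c ≤ min 1 η := by rwa [le_div_iff₀ hc] at hα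
  obtain ⟨s, hs, hs1, hsle⟩ := hexpSum (alpha A ρ) hα0 (hαc.trans (min_le_left _ _))
  have hsη : s ≤ 1 + η := by linarith [min_le_right 1 η]
  have hσ : ∀ b ∈ B, s ^ n b ≤ 1 + d / 4 ∧ s ^ n b⁻¹ ≤ 1 + d / 4 := by
    have h : ∀ k ≤ N, s ^ k ≤ 1 + d / 4 := fun k hk =>
      (pow_le_pow_right₀ hs1 hk).trans ((pow_le_pow_left₀ (by linarith) hsη N).trans hηN)
    exact fun b hb => ⟨h _ (hN b hb).1, h _ (hN b hb).2⟩
  have hmk := hasSum_markovH (ρ := ρ) hA hs.summable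
  refine ⟨hmk, fun f hf => ?_, fun f l hl hf => ?_⟩
  · have hpb : ∀ b, ‖koopman (ρ b)‖ ≤ 1 → ∀ δ' ≤ δ b,
        ‖markovH μ ρ ^ n b - δ' • koopman (ρ b)‖ ≤ s ^ n b - δ' := fun b hb δ' hδ' =>
      hpow b δ' hδ' (fun γ => koopman (ρ γ)) _ _ s (by rw [map_one, koopman_one])
        (fun γ η => by rw [map_mul, koopman_mul])
        (fun γ => norm_koopman_le fun x => timeFactor_le hA ρ γ x)
        (fun γ => Real.one_le_exp (by positivity)) hmk hs hb
    have h := norm_avgPow_le hB n (markovH μ ρ) (fun b => koopman (ρ b)) hδ₀.le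
      (fun b hb => ⟨hpb b (norm_koopman_le_one_of_mem_K (hK b hb)) _ (hδB b hb).1,
        hpb b⁻¹ (by rw [map_inv]; exact norm_koopman_inv_le_one_of_mem_K (hK b hb)) _
          (hδB b hb).2⟩) hσ (κ := κ₀) (x := f) (by
        simpa only [map_inv] using norm_sum_koopman_le_repGap B hB ρ hK hκ₀.le hgap f hf)
    refine h.trans (mul_le_mul_of_nonneg_right ?_ (norm_nonneg f))
    linarith [min_le_right 1 (δ₀ * κ₀ / B.card)]
  · refine avgPow_mem (P := LipBound) (fun a b x y hx hy u v => ?_) (fun c a x hc hx u v => ?_)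
      (fun u v => ?_) (fun a b x hab hx u v => ?_) hB n (s := s) (by linarith)
      (fun a x ha hx => markovC_lipBound hA hs ha hx) hσ hl hf
    · have h1 := hx u v
      have h2 := hy u v
      have h3 := abs_add_le (x u - x v) (y u - y v)
      simp only [ContinuousMap.add_apply]
      rw [show x u + y u - (x v + y v) = x u - x v + (y u - y v) by ring]
      linarith
    · simp only [ContinuousMap.smul_apply, smul_eq_mul]
      rw [← mul_sub, abs_mul, abs_of_nonneg hc, mul_assoc]
      exact mul_le_mul_of_nonneg_left (hx u v) hc
    · simp
    · exact (hx u v).trans (mul_le_mul_of_nonneg_right hab dist_nonneg)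

/-! ### Stationary measures -/

/-- The convolution `μ * ν = ∑ μ(γ) ρ(γ)_* ν`. -/
def conv (μ : PMF Γ) (ρ : Γ →* SO31) (ν : Measure S2) : Measure S2 :=
  Measure.sum fun γ => μ γ • ν.map fun x => ρ γ • x

theorem hasSum_integral_conv {ν : Measure S2} {f : S2 → ℝ} (hf : Integrable f (conv μ ρ ν)) :
    (∀ γ ∈ μ.support, Integrable (fun x => f (ρ γ • x)) ν) ∧
      HasSum (fun γ => (μ γ).toReal * ∫ x, f (ρ γ • x) ∂ν) (∫ x, f x ∂conv μ ρ ν) := by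
  have hI : ∀ γ ∈ μ.support, Integrable f (ν.map fun x => ρ γ • x) := by
    intro γ hγ
    have h1 := hf.mono_measure (Measure.le_sum _ γ)
    exact (integrable_smul_measure ((μ.mem_support_iff γ).1 hγ) (μ.apply_ne_top γ)).1 h1
  refine ⟨fun γ hγ => (hI γ hγ).comp_measurable (measurable_smul_S2 _),
    (hasSum_integral_measure hf).congr_fun fun γ => ?_⟩
  rw [integral_smul_measure, smul_eq_mul]
  by_cases hγ : γ ∈ μ.support
  · rw [integral_map (measurable_smul_S2 _).aemeasurable (hI γ hγ).aestronglyMeasurable]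
  · simp [(μ.apply_eq_zero_iff γ).2 hγ]

instance isProbabilityMeasure_conv (μ : PMF Γ) (ρ : Γ →* SO31) (ν : Measure S2)
    [IsProbabilityMeasure ν] : IsProbabilityMeasure (conv μ ρ ν) := by
  constructor
  have h : ∀ γ, (ν.map fun x => ρ γ • x) Set.univ = 1 := fun γ => by
    rw [Measure.map_apply (measurable_smul_S2 _) .univ, Set.preimage_univ, measure_univ]
  rw [conv, Measure.sum_apply _ .univ]
  simp [h, μ.tsum_coe]

theorem hasSum_integral_stationary {ν : Measure S2} (hν : IsStationary μ ρ ν) {f : S2 → ℝ}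
    (hf : Integrable f ν) : (∀ γ ∈ μ.support, Integrable (fun x => f (ρ γ • x)) ν) ∧
      HasSum (fun γ => (μ γ).toReal * ∫ x, f (ρ γ • x) ∂ν) (∫ x, f x ∂ν) := by
  have hst : conv μ ρ ν = ν := hν.2
  have h := hasSum_integral_conv (μ := μ) (ρ := ρ) (ν := ν) (f := f) (by rwa [hst])
  rwa [hst] at h

theorem integrable_continuousMap (f : C(S2, ℝ)) (ν : Measure S2) [IsFiniteMeasure ν] :
    Integrable f ν :=
  (BoundedContinuousFunction.mkOfCompact f).integrable ν

/-- Integration against a probability measure, as a functional on the continuous functions. -/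
def integralC (ν : Measure S2) [IsProbabilityMeasure ν] : C(S2, ℝ) →L[ℝ] ℝ :=
  LinearMap.mkContinuous
    { toFun := fun f => ∫ x, f x ∂ν
      map_add' := fun f g =>
        integral_add (integrable_continuousMap f ν) (integrable_continuousMap g ν)
      map_smul' := fun c f => integral_const_mul c _ } 1 fun f => by
    have h := norm_integral_le_of_norm_le_const (μ := ν)
      (Filter.Eventually.of_forall fun x => f.norm_coe_le_norm x)
    rw [probReal_univ, mul_comm] at h
    exact h

theorem hasSum_integral_markovC (ν : Measure S2) [IsProbabilityMeasure ν] (f : C(S2, ℝ)) :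
    HasSum (fun γ => (μ γ).toReal * ∫ x, f (ρ γ • x) ∂ν) (∫ x, markovC μ ρ f x ∂ν) :=
  ((hasSum_markovC_apply μ ρ f).mapL (integralC ν)).congr_fun fun γ => by
    rw [map_smul, smul_eq_mul]; rfl

theorem integral_conv (ν : Measure S2) [IsProbabilityMeasure ν] (f : C(S2, ℝ)) :
    ∫ x, f x ∂conv μ ρ ν = ∫ x, markovC μ ρ f x ∂ν :=
  (hasSum_integral_conv (integrable_continuousMap f _)).2.unique (hasSum_integral_markovC ν f)

/-- A finite measure on the sphere is determined by the integrals of continuous functions. -/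
theorem isStationary_iff {ν : Measure S2} [IsProbabilityMeasure ν] :
    IsStationary μ ρ ν ↔ ∀ f : C(S2, ℝ), ∫ x, markovC μ ρ f x ∂ν = ∫ x, f x ∂ν := by
  refine ⟨fun h f => ?_, fun h => ⟨inferInstance, ?_⟩⟩
  · rw [← integral_conv, show conv μ ρ ν = ν from h.2]
  · change conv μ ρ ν = ν
    refine ext_of_forall_integral_eq_of_IsFiniteMeasure fun f => ?_
    exact (integral_conv ν f.toContinuousMap).trans (h _)

theorem integral_avgPow_eq {ν : Measure S2} (hν : IsStationary μ ρ ν) {B : Finset Γ}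
    (hB : B.Nonempty) (n : Γ → ℕ) (k : ℕ) (f : C(S2, ℝ)) :
    ∫ x, (avgPow B n (markovC μ ρ) ^ k) f x ∂ν = ∫ x, f x ∂ν := by
  have := hν.1
  have h1 : ∀ f : C(S2, ℝ), integralC ν (markovC μ ρ f) = integralC ν f := isStationary_iff.1 hν
  have h2 : ∀ f : C(S2, ℝ), integralC ν (avgPow B n (markovC μ ρ) f) = integralC ν f := fun f => by
    rw [← avgPow_intertwine B n (S := ContinuousLinearMap.id ℝ ℝ) (fun x => (h1 x).symm),
      avgPow_apply_eq_self hB n rfl]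
  change integralC ν _ = integralC ν f
  rw [← pow_intertwine (S := ContinuousLinearMap.id ℝ ℝ) (fun x => (h2 x).symm),
    pow_apply_eq_self rfl]

/-- Functions whose Lipschitz constants grow slowly and whose `L²` norms decay fast tend to zero
uniformly. -/
theorem exists_abs_lt_of_lipBound {σ q : ℝ} (hσ : 1 ≤ σ) (hσq : σ ^ 3 * q ^ 2 < 1)
    (h : ℕ → C(S2, ℝ)) {l η : ℝ} (hL : ∀ k, LipBound (σ ^ k * l) (h k))
    (h2 : ∀ k, ‖toH (h k)‖ ≤ q ^ k * η) {M : ℝ} (hM : 0 < M) :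
    ∃ k, ∀ x, |h k x| < M := by
  obtain ⟨c, hc, hbd⟩ := exists_lipschitz_bound
  -- with `M ≤ l'` the radius `M / (2 σ ^ k l')` is at most `1`
  set l' := max l M with hl'
  have hl'0 : 0 < l' := lt_max_of_lt_right hM
  have key : ∀ k x, M ≤ |h k x| → c * M ^ 5 / (8 * l' ^ 3) ≤ (σ ^ 3 * q ^ 2) ^ k * η ^ 2 := by
    intro k x hx
    have hσk : 1 ≤ σ ^ k := one_le_pow₀ hσ
    have hr : M / (2 * (σ ^ k * l')) ≤ 1 := by
      rw [div_le_one (by positivity)]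
      have : M ≤ l' := le_max_right _ _
      nlinarith
    have h1 := hbd (h k) (σ ^ k * l') M (M / (2 * (σ ^ k * l'))) x (by positivity)
      (fun y z => (hL k y z).trans (by gcongr; exact le_max_left _ _)) hM hx (by positivity) hr
      (le_of_eq (by field_simp))
    have h3 : ‖toH (h k)‖ ^ 2 ≤ (q ^ k * η) ^ 2 := pow_le_pow_left₀ (norm_nonneg _) (h2 k) 2
    have h4 := h1.trans h3
    have e1 : c * M ^ 2 * (M / (2 * (σ ^ k * l'))) ^ 3 =
        c * M ^ 5 / (8 * l' ^ 3) / (σ ^ k) ^ 3 := by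
      field_simp
      ring
    rw [e1, div_le_iff₀ (by positivity)] at h4
    refine h4.trans (le_of_eq ?_)
    rw [mul_pow, mul_pow, ← pow_mul, ← pow_mul, ← pow_mul, ← pow_mul, mul_comm k 3, mul_comm k 2]
    ring
  have hlim : Tendsto (fun k : ℕ => (σ ^ 3 * q ^ 2) ^ k * η ^ 2) atTop (𝓝 (0 * η ^ 2)) :=
    (tendsto_pow_atTop_nhds_zero_of_lt_one (by positivity) hσq).mul_const _
  rw [zero_mul] at hlim
  obtain ⟨k, hk⟩ := (hlim.eventually_lt_const
    (show 0 < c * M ^ 5 / (8 * l' ^ 3) by positivity)).exists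
  refine ⟨k, fun x => ?_⟩
  by_contra hx
  exact absurd (key k x (not_lt.1 hx)) (not_le.2 hk)

theorem inner_one_sub_mean (f : C(S2, ℝ)) :
    inner ℝ (toH 1) (toH (f - (∫ x, f x ∂m) • (1 : C(S2, ℝ)))) = 0 := by
  rw [map_sub, map_smul, inner_sub_right, inner_smul_right, inner_one_toH,
    real_inner_self_eq_norm_sq, norm_one_H]
  ring

theorem norm_sub_mean_le (u : H) : ‖u - (inner ℝ (toH 1) u) • toH 1‖ ≤ ‖u‖ := by
  have h1 : ‖u - (inner ℝ (toH 1) u) • toH 1‖ ^ 2 = ‖u‖ ^ 2 - inner ℝ (toH 1) u ^ 2 := by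
    rw [norm_sub_sq_real, norm_smul, norm_one_H, inner_smul_right, real_inner_comm, mul_one,
      Real.norm_eq_abs, sq_abs]
    ring
  refine (sq_le_sq₀ (norm_nonneg _) (norm_nonneg _)).1 ?_
  rw [h1]
  nlinarith [sq_nonneg (inner ℝ (toH 1) u)]

/-- The integral of a Lipschitz function `f` against any stationary measure is the limit of the
means of `Q^k f`, where `Q` is the average of powers of the Markov operator. -/
theorem stationary_unique {B : Finset Γ} (hB : B.Nonempty) {n : Γ → ℕ} {q σ : ℝ} (hq : 0 ≤ q)
    (hσ : 1 ≤ σ) (hσq : σ ^ 3 * q ^ 2 < 1)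
    (hmk : HasSum (fun γ => (μ γ).toReal • koopman (ρ γ)) (markovH μ ρ))
    (hQ : ∀ f, inner ℝ (toH 1) f = 0 → ‖avgPow B n (markovH μ ρ) f‖ ≤ q * ‖f‖)
    (hQC : ∀ (f : C(S2, ℝ)) (l : ℝ), 0 ≤ l → LipBound l f →
      LipBound (σ * l) (avgPow B n (markovC μ ρ) f))
    {ν ν' : Measure S2} (hν : IsStationary μ ρ ν) (hν' : IsStationary μ ρ ν') : ν' = ν := by
  have hp := hν.1
  have hp' := hν'.1
  set Q := avgPow B n (markovC μ ρ) with hQdef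
  have hQ1 : Q 1 = 1 := avgPow_apply_eq_self hB n markovC_one
  -- the integrals of Lipschitz functions agree
  have key : ∀ (f : C(S2, ℝ)) (l : ℝ), 0 ≤ l → LipBound l f → ∫ x, f x ∂ν' = ∫ x, f x ∂ν := by
    intro f l hl hf
    -- remove the mean after each application of `Q`
    let c : ℕ → ℝ := fun k => ∫ x, (Q ^ k) f x ∂m
    let h : ℕ → C(S2, ℝ) := fun k => (Q ^ k) f - c k • (1 : C(S2, ℝ))
    have hLip : ∀ k, LipBound (σ ^ k * l) ((Q ^ k) f) := by
      intro k
      induction k with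
      | zero => simpa using hf
      | succ k ih =>
        rw [pow_succ', pow_succ', mul_apply_eq_comp, mul_assoc]
        exact hQC _ _ (by positivity) ih
    have hL : ∀ k, LipBound (σ ^ k * l) (h k) := fun k y z => by
      simpa [h] using hLip k y z
    have hmean : ∀ k, inner ℝ (toH 1) (toH (h k)) = 0 := fun k => inner_one_sub_mean _
    have hnorm : ∀ k, ‖toH (h k)‖ ≤ q ^ k * ‖toH (h 0)‖ := by
      intro k
      induction k with
      | zero => simp
      | succ k ih =>
        have e1 : toH (h (k + 1)) = toH (Q (h k)) - (inner ℝ (toH 1) (toH (Q (h k)))) • toH 1 := by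
          have e2 : Q (h k) = (Q ^ (k + 1)) f - c k • (1 : C(S2, ℝ)) := by
            simp only [h, map_sub, map_smul, hQ1, pow_succ', mul_apply_eq_comp]
          have e3 : inner ℝ (toH 1) (toH (Q (h k))) = c (k + 1) - c k := by
            rw [e2, map_sub, map_smul, inner_sub_right, inner_smul_right, inner_one_toH,
              real_inner_self_eq_norm_sq, norm_one_H]
            simp [c]
          rw [e3, e2]
          simp only [h, map_sub, map_smul, sub_smul]
          abel
        rw [e1, pow_succ', mul_assoc]
        refine (norm_sub_mean_le _).trans ?_
        rw [hQdef, ← avgPow_intertwine B n (markovH_toH hmk)]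
        exact (hQ _ (hmean k)).trans (mul_le_mul_of_nonneg_left ih hq)
    rw [← sub_eq_zero, ← abs_nonpos_iff]
    refine le_of_forall_pos_le_add fun M hM => ?_
    obtain ⟨k, hk⟩ := exists_abs_lt_of_lipBound hσ hσq h hL hnorm (half_pos hM)
    have hint : ∀ (ν : Measure S2), IsStationary μ ρ ν → |∫ x, f x ∂ν - c k| ≤ M / 2 := by
      intro ν hν
      have := hν.1
      have e : ∫ x, f x ∂ν - c k = integralC ν (h k) := by
        have e4 : integralC ν 1 = 1 := by
          change ∫ x, (1 : ℝ) ∂ν = 1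
          simp
        simp only [h]
        rw [map_sub, map_smul, e4, smul_eq_mul, mul_one]
        congr 1
        exact (integral_avgPow_eq hν hB n k f).symm
      rw [e]
      have h5 := norm_integral_le_of_norm_le_const (μ := ν) (f := h k) (C := M / 2)
        (Filter.Eventually.of_forall fun x => (hk x).le)
      rw [probReal_univ, mul_one] at h5
      exact h5
    have h6 := hint ν hν
    have h7 := hint ν' hν'
    rcases abs_le.1 h6 with ⟨h8, h9⟩
    rcases abs_le.1 h7 with ⟨h10, h11⟩
    rw [zero_add, abs_le]
    constructor <;> linarith
  let P : ProbabilityMeasure S2 := ⟨ν, hp⟩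
  let P' : ProbabilityMeasure S2 := ⟨ν', hp'⟩
  have hconv : Tendsto (fun _ : ℕ => P') atTop (𝓝 P) := by
    rw [tendsto_iff_forall_lipschitz_integral_tendsto]
    rintro f - ⟨L, hL⟩
    have := key ⟨f, hL.continuous⟩ L L.2 fun y z => by
      simpa [Real.dist_eq] using hL.dist_le_mul y z
    change Tendsto (fun _ : ℕ => ∫ x, f x ∂ν') atTop (𝓝 (∫ x, f x ∂ν))
    rw [← show ∫ x, f x ∂ν' = ∫ x, f x ∂ν from this]
    exact tendsto_const_nhds
  have hPP : P' = P := tendsto_nhds_unique tendsto_const_nhds hconv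
  exact congrArg Subtype.val hPP

theorem integral_withDensity_ofReal {φ : S2 → ℝ} (hφ : Measurable φ) (h0 : ∀ x, 0 ≤ φ x)
    (f : S2 → ℝ) :
    ∫ x, f x ∂(m.withDensity fun x => ENNReal.ofReal (φ x)) = ∫ x, φ x * f x ∂m := by
  rw [integral_withDensity_eq_integral_toReal_smul hφ.ennreal_ofReal
    (Filter.Eventually.of_forall fun x => ENNReal.ofReal_lt_top)]
  simp only [ENNReal.toReal_ofReal (h0 _), smul_eq_mul]

theorem integrable_withDensity_ofReal_iff {φ : S2 → ℝ} (hφ : Measurable φ) (h0 : ∀ x, 0 ≤ φ x)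
    {f : S2 → ℝ} : Integrable f (m.withDensity fun x => ENNReal.ofReal (φ x)) ↔
      Integrable (fun x => φ x * f x) m := by
  rw [integrable_withDensity_iff_integrable_smul' hφ.ennreal_ofReal
    (Filter.Eventually.of_forall fun x => ENNReal.ofReal_lt_top)]
  simp only [ENNReal.toReal_ofReal (h0 _), smul_eq_mul]

/-- The density is the fixed vector of the adjoint of the Markov operator. It is non-negative
because the average `Q` of powers of the Markov operator is positive. -/
theorem exists_stationary_density {B : Finset Γ} (hB : B.Nonempty) {n : Γ → ℕ} {q : ℝ} (hq : 0 ≤ q)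
    (hq1 : q < 1)
    (hmk : HasSum (fun γ => (μ γ).toReal • koopman (ρ γ)) (markovH μ ρ))
    (hQ : ∀ f, inner ℝ (toH 1) f = 0 → ‖avgPow B n (markovH μ ρ) f‖ ≤ q * ‖f‖) :
    ∃ φ : S2 → ℝ, Measurable φ ∧ (∀ x, 0 ≤ φ x) ∧ MemLp φ 2 m ∧
      IsStationary μ ρ (m.withDensity fun x => ENNReal.ofReal (φ x)) := by
  have hT1 : markovH μ ρ (toH 1) = toH 1 := by rw [markovH_toH hmk, markovC_one]
  obtain ⟨φ, hφ1, hφT, hφpos⟩ := exists_adjoint_fixed (T := markovH μ ρ)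
    (Q := avgPow B n (markovH μ ρ)) norm_one_H hT1 (avgPow_apply_eq_self hB n hT1)
    (commute_avgPow B n _) hq hq1 hQ
  have hsmul : ∀ (a : ℝ) (u : H), 0 ≤ a → 0 ≤ u → 0 ≤ a • u := fun a u ha hu => by
    rw [← Lp.coeFn_nonneg] at hu ⊢
    filter_upwards [hu, Lp.coeFn_smul a u] with x h1 h2
    rw [h2]
    exact mul_nonneg ha h1
  have hQpos : ∀ (k : ℕ) (f : H), 0 ≤ f → 0 ≤ ((avgPow B n (markovH μ ρ)) ^ k) f := by
    intro k
    induction k with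
    | zero => exact fun f hf => hf
    | succ k ih =>
      intro f hf
      rw [pow_succ, mul_apply_eq_comp]
      exact ih _ (avgPow_mem (P := fun _ x => 0 ≤ x) (fun _ _ _ _ => add_nonneg)
        (fun c _ x hc hx => hsmul c x hc hx) le_rfl (fun _ _ _ _ h => h) hB n (s := 1)
        (σ := 1) (a := 0) zero_le_one
        (fun _ x _ hx => markovH_nonneg hmk hx) (by simp) le_rfl hf)
  -- the inner product of `φ` with its negative part is non-negative, so the negative part vanishes
  have hφ0 : 0 ≤ φ := by
    have hneg := Lp.coeFn_negPart φ
    have h1 : 0 ≤ Lp.negPart φ := by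
      rw [← Lp.coeFn_nonneg]
      filter_upwards [hneg] with x hx
      rw [hx]
      simp
    have h2 := hφpos (Lp.negPart φ) fun k => by
      rw [inner_one]
      exact integral_nonneg_of_ae ((Lp.coeFn_nonneg _).2 (hQpos k _ h1))
    have h3 : inner ℝ φ (Lp.negPart φ) = -‖Lp.negPart φ‖ ^ 2 := by
      rw [← real_inner_self_eq_norm_sq, L2.inner_def, L2.inner_def, ← integral_neg]
      refine integral_congr_ae ?_
      filter_upwards [hneg] with x hx
      rw [hx]
      rcases le_total (φ x) 0 with h | h
      · simp [h, sq]
      · simp [h]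
    have h4 : ‖Lp.negPart φ‖ = 0 := by nlinarith [norm_nonneg (Lp.negPart φ)]
    rw [norm_eq_zero] at h4
    rw [← Lp.coeFn_nonneg]
    rw [h4] at hneg
    filter_upwards [hneg, Lp.coeFn_zero ℝ 2 m] with x hx h0
    rw [h0] at hx
    simp only [Pi.zero_apply] at hx ⊢
    exact min_eq_right_iff.1 (by linarith)
  have hφae : (fun x => max (φ x) 0) =ᵐ[m] φ := by
    filter_upwards [(Lp.coeFn_nonneg φ).2 hφ0] with x hx
    exact max_eq_left hx
  have hmeas : Measurable fun x => max (φ x) 0 :=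
    (Lp.stronglyMeasurable φ).measurable.max measurable_const
  have hL2 : MemLp (fun x => max (φ x) 0) 2 m := (Lp.memLp φ).ae_eq hφae.symm
  have hint : ∀ f : C(S2, ℝ), ∫ x, f x ∂(m.withDensity fun x => ENNReal.ofReal (max (φ x) 0))
      = inner ℝ φ (toH f) := by
    intro f
    rw [integral_withDensity_ofReal hmeas (fun x => le_max_right _ _), real_inner_comm, inner_toH]
    refine integral_congr_ae ?_
    filter_upwards [hφae] with x hx
    rw [hx, mul_comm]
  have hprob : IsProbabilityMeasure (m.withDensity fun x => ENNReal.ofReal (max (φ x) 0)) := by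
    constructor
    rw [withDensity_apply _ .univ, setLIntegral_univ,
      ← ofReal_integral_eq_lintegral_ofReal (hL2.integrable (by norm_num))
      (Filter.Eventually.of_forall fun x => le_max_right _ _), integral_congr_ae hφae, ← inner_one,
      hφ1, ENNReal.ofReal_one]
  refine ⟨_, hmeas, fun x => le_max_right _ _, hL2, isStationary_iff.2 fun f => ?_⟩
  rw [hint, hint, ← markovH_toH hmk, hφT]

end Markov

/-! ### The entropy of a stationary measure with a density -/

/-- The measure of density `φ` with respect to `m`. -/
abbrev densityMeasure (φ : S2 → ℝ) : Measure S2 := m.withDensity fun x => ENNReal.ofReal (φ x)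

section Entropy

variable {Γ : Type*} [Group Γ] {A : Finset Γ} {μ : PMF Γ} {ρ : Γ →* SO31}

/-- As `μ` generates `Γ` as a semigroup, the whole group preserves the class of null sets of a
stationary measure. -/
theorem stationary_absolutelyContinuous (hgen : GeneratesAsSemigroup μ) {ν : Measure S2}
    (hν : IsStationary μ ρ ν) (γ : Γ) : ν.map (fun x => ρ γ • x) ≪ ν := by
  have hγ : γ ∈ Submonoid.closure μ.support := by
    rw [show Submonoid.closure μ.support = ⊤ from hgen]; trivial
  induction hγ using Submonoid.closure_induction with
  | mem γ hγ =>
    intro s hs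
    rw [← hν.2] at hs
    have h1 := (Measure.le_iff'.1
      (Measure.le_sum (fun γ => μ γ • ν.map fun x => ρ γ • x) γ) s).trans hs.le
    rw [nonpos_iff_eq_zero, Measure.smul_apply, smul_eq_mul, mul_eq_zero] at h1
    exact h1.resolve_left ((μ.mem_support_iff γ).1 hγ)
  | one =>
    have e : (fun x : S2 => ρ (1 : Γ) • x) = id := by
      funext x; simp
    rw [e, Measure.map_id]
  | mul γ η _ _ h1 h2 =>
    have e : (fun x : S2 => ρ (γ * η) • x) = (fun x => ρ γ • x) ∘ fun x => ρ η • x := by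
      funext x; simp [mul_smul]
    rw [e, ← Measure.map_map (measurable_smul_S2 _) (measurable_smul_S2 _)]
    exact (h2.map (measurable_smul_S2 _)).trans h1

theorem map_inv_densityMeasure (g : SO31) {φ : S2 → ℝ} (hφ : Measurable φ) :
    (densityMeasure φ).map (fun x => g⁻¹ • x) =
      densityMeasure fun x => φ (g • x) * (timeFactor g x)⁻¹ ^ 2 := by
  have ht : Measurable fun x => (timeFactor g x)⁻¹ ^ 2 :=
    (continuous_timeFactor g).measurable.inv.pow_const 2
  have h1 : Measurable fun x => φ (g • x) * (timeFactor g x)⁻¹ ^ 2 :=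
    (hφ.comp (measurable_smul_S2 g)).mul ht
  refine Measure.ext_of_lintegral _ fun F hF => ?_
  have hFg : Measurable fun x => F (g⁻¹ • x) := hF.comp (measurable_smul_S2 g⁻¹)
  rw [lintegral_map hF (measurable_smul_S2 _),
    lintegral_withDensity_eq_lintegral_mul _ hφ.ennreal_ofReal hFg,
    lintegral_withDensity_eq_lintegral_mul _ h1.ennreal_ofReal hF,
    ← lintegral_smul_m g _ (hφ.ennreal_ofReal.mul hFg)]
  refine lintegral_congr fun x => ?_
  simp only [Pi.mul_apply, inv_smul_smul]
  rw [ENNReal.ofReal_mul' (by positivity)]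
  ring

/-- The Radon-Nikodym derivative is the quotient of the densities with respect to `m`. The density
`φ` may vanish on a set of positive `m`-measure, but for `ν`-almost every `x` it vanishes neither
at `x` nor at `ρ(γ) x`. -/
theorem cocycle_ae (hgen : GeneratesAsSemigroup μ) {φ : S2 → ℝ} (hφ : Measurable φ)
    (hν : IsStationary μ ρ (densityMeasure φ)) (γ : Γ) :
    ∀ᵐ x ∂densityMeasure φ, 0 < φ x ∧ 0 < φ (ρ γ • x) ∧ cocycle ρ (densityMeasure φ) γ x =
      Real.log (φ x) - Real.log (φ (ρ γ • x)) + 2 * Real.log (timeFactor (ρ γ) x) := by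
  have := hν.1
  have hac : densityMeasure φ ≪ m := withDensity_absolutelyContinuous _ _
  have hpos : ∀ᵐ x ∂densityMeasure φ, 0 < φ x := by
    rw [ae_withDensity_iff hφ.ennreal_ofReal]
    refine Filter.Eventually.of_forall fun x hx => ?_
    simpa using hx
  have hpos' : ∀ᵐ x ∂densityMeasure φ, 0 < φ (ρ γ • x) :=
    Measure.QuasiMeasurePreserving.ae
      ⟨measurable_smul_S2 (ρ γ), stationary_absolutelyContinuous hgen hν γ⟩ hpos
  have hac' : (densityMeasure φ).map (fun y => (ρ γ)⁻¹ • y) ≪ densityMeasure φ := by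
    have := stationary_absolutelyContinuous hgen hν γ⁻¹
    rwa [map_inv] at this
  have hprob : IsProbabilityMeasure ((densityMeasure φ).map fun y => (ρ γ)⁻¹ • y) :=
    Measure.isProbabilityMeasure_map (measurable_smul_S2 _).aemeasurable
  have hR := Measure.rnDeriv_mul_rnDeriv (κ := m) hac'
  have h1 : Measurable fun x => φ (ρ γ • x) * (timeFactor (ρ γ) x)⁻¹ ^ 2 :=
    (hφ.comp (measurable_smul_S2 _)).mul ((continuous_timeFactor _).measurable.inv.pow_const 2)
  have hd1 := Measure.rnDeriv_withDensity m hφ.ennreal_ofReal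
  have hd2 : ((densityMeasure φ).map fun y => (ρ γ)⁻¹ • y).rnDeriv m =ᵐ[m]
      fun x => ENNReal.ofReal (φ (ρ γ • x) * (timeFactor (ρ γ) x)⁻¹ ^ 2) := by
    rw [map_inv_densityMeasure _ hφ]
    exact Measure.rnDeriv_withDensity m h1.ennreal_ofReal
  filter_upwards [hpos, hpos', hac.ae_le hR, hac.ae_le hd1, hac.ae_le hd2] with x hx hx' e1 e2 e3
  refine ⟨hx, hx', ?_⟩
  have ht := timeFactor_pos (ρ γ) x
  rw [Pi.mul_apply, e2, e3] at e1
  have e4 := congrArg ENNReal.toReal e1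
  rw [ENNReal.toReal_mul, ENNReal.toReal_ofReal hx.le, ENNReal.toReal_ofReal (by positivity)] at e4
  rw [cocycle, eq_div_of_mul_eq hx.ne' e4, Real.log_div (by positivity) hx.ne',
    Real.log_mul hx'.ne' (by positivity), Real.log_pow, Real.log_inv]
  push_cast
  ring

/-- `|φ log φ| ≤ 1 + φ²`, by `1 - φ⁻¹ ≤ log φ ≤ φ - 1`. -/
theorem integrable_log_density {φ : S2 → ℝ} (hφ : Measurable φ) (h0 : ∀ x, 0 ≤ φ x)
    (hL2 : MemLp φ 2 m) : Integrable (fun x => Real.log (φ x)) (densityMeasure φ) := by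
  rw [integrable_withDensity_ofReal_iff hφ h0]
  refine ((integrable_const 1).add ((memLp_two_iff_integrable_sq hφ.aestronglyMeasurable).1
    hL2)).mono' (hφ.mul hφ.log).aestronglyMeasurable (Filter.Eventually.of_forall fun x => ?_)
  simp only [Pi.add_apply]
  rcases (h0 x).eq_or_lt with h | h
  · simp [← h]
  · have h1 := Real.log_le_sub_one_of_pos h
    have h2 := Real.one_sub_inv_le_log_of_pos h
    have h3 : φ x * (1 - (φ x)⁻¹) = φ x - 1 := by field_simp
    rw [Real.norm_eq_abs, abs_le]
    constructor <;> nlinarith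

theorem abs_log_timeFactor_le (hA : Subgroup.closure (A : Set Γ) = ⊤) (γ : Γ) (x : S2) :
    |2 * Real.log (timeFactor (ρ γ) x)| ≤ alpha A ρ * wordLength A γ := by
  have ht := timeFactor_pos (ρ γ) x
  have h1 := (Real.log_le_iff_le_exp ht).2 (timeFactor_le hA ρ γ x)
  have h2 := (Real.log_le_iff_le_exp (inv_pos.2 ht)).2 (inv_timeFactor_le hA ρ γ x)
  rw [Real.log_inv] at h2
  rw [abs_le]
  constructor <;> linarith

theorem continuous_log_timeFactor (g : SO31) : Continuous fun x => 2 * Real.log (timeFactor g x) :=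
  continuous_const.mul ((continuous_timeFactor g).log fun x => (timeFactor_pos g x).ne')

theorem integrable_log_timeFactor (g : SO31) (ν : Measure S2) [IsFiniteMeasure ν] :
    Integrable (fun x => 2 * Real.log (timeFactor g x)) ν :=
  integrable_continuousMap ⟨_, continuous_log_timeFactor g⟩ ν

theorem abs_integral_log_timeFactor_le (hA : Subgroup.closure (A : Set Γ) = ⊤) (γ : Γ)
    (ν : Measure S2) [IsProbabilityMeasure ν] :
    |∫ x, 2 * Real.log (timeFactor (ρ γ) x) ∂ν| ≤ alpha A ρ * wordLength A γ := by
  have h := norm_integral_le_of_norm_le_const (μ := ν)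
    (f := fun x => 2 * Real.log (timeFactor (ρ γ) x)) (C := alpha A ρ * wordLength A γ)
    (Filter.Eventually.of_forall fun x => abs_log_timeFactor_le hA γ x)
  rwa [probReal_univ, mul_one] at h

theorem integrable_cocycle (hgen : GeneratesAsSemigroup μ) {φ : S2 → ℝ} (hφ : Measurable φ)
    (h0 : ∀ x, 0 ≤ φ x) (hL2 : MemLp φ 2 m) (hν : IsStationary μ ρ (densityMeasure φ))
    {γ : Γ} (hγ : γ ∈ μ.support) :
    Integrable (cocycle ρ (densityMeasure φ) γ) (densityMeasure φ) := by
  have := hν.1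
  have hl := integrable_log_density hφ h0 hL2
  have h1 := (hasSum_integral_stationary hν hl).1 γ hγ
  refine ((hl.sub h1).add (integrable_log_timeFactor (ρ γ) _)).congr ?_
  filter_upwards [cocycle_ae hgen hφ hν γ] with x hx
  exact hx.2.2.symm

theorem entropyIntegrable (hA : Subgroup.closure (A : Set Γ) = ⊤) (hgen : GeneratesAsSemigroup μ)
    (hmom : Summable fun γ => (μ γ).toReal * (wordLength A γ : ℝ)) {φ : S2 → ℝ}
    (hφ : Measurable φ) (h0 : ∀ x, 0 ≤ φ x) (hL2 : MemLp φ 2 m)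
    (hν : IsStationary μ ρ (densityMeasure φ)) : EntropyIntegrable μ ρ (densityMeasure φ) := by
  have := hν.1
  refine ⟨fun γ hγ => integrable_cocycle hgen hφ h0 hL2 hν hγ, ?_⟩
  have hl := integrable_log_density hφ h0 hL2
  have hs := hasSum_integral_stationary hν hl.abs
  set I := ∫ x, |Real.log (φ x)| ∂densityMeasure φ
  refine Summable.of_nonneg_of_le (fun γ => by positivity) (fun γ => ?_)
    ((((hasSum_toReal_pmf μ).mul_right I).summable.add hs.2.summable).add
      (hmom.mul_left (alpha A ρ)))
  by_cases hγ : γ ∈ μ.support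
  · have h1 := hs.1 γ hγ
    have h2 : ∫ x, |cocycle ρ (densityMeasure φ) γ x| ∂densityMeasure φ ≤
        ∫ x, (|Real.log (φ x)| + |Real.log (φ (ρ γ • x))| + alpha A ρ * wordLength A γ)
          ∂densityMeasure φ := by
      refine integral_mono_ae (integrable_cocycle hgen hφ h0 hL2 hν hγ).abs
        ((hl.abs.add h1).add (integrable_const _)) ?_
      filter_upwards [cocycle_ae hgen hφ hν γ] with x hx
      simp only [hx.2.2]
      have h3 := abs_log_timeFactor_le (ρ := ρ) hA γ x
      have h4 := abs_sub (Real.log (φ x)) (Real.log (φ (ρ γ • x)))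
      exact (abs_add_le _ _).trans (add_le_add h4 h3)
    have h12 : Integrable (fun x => |Real.log (φ x)| + |Real.log (φ (ρ γ • x))|)
        (densityMeasure φ) := hl.abs.add h1
    rw [integral_add h12 (integrable_const _), integral_add hl.abs h1, integral_const,
      probReal_univ, one_smul] at h2
    have h5 := mul_le_mul_of_nonneg_left h2 (ENNReal.toReal_nonneg (a := μ γ))
    refine h5.trans (le_of_eq ?_)
    ring
  · simp [(μ.apply_eq_zero_iff γ).2 hγ]

/-- The logarithms of the density cancel by stationarity, and the entropy is the mean of the
logarithmic conformal factors. -/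
theorem hasSum_entropy (hA : Subgroup.closure (A : Set Γ) = ⊤) (hgen : GeneratesAsSemigroup μ)
    (hmom : Summable fun γ => (μ γ).toReal * (wordLength A γ : ℝ)) {φ : S2 → ℝ}
    (hφ : Measurable φ) (h0 : ∀ x, 0 ≤ φ x) (hL2 : MemLp φ 2 m)
    (hν : IsStationary μ ρ (densityMeasure φ)) :
    HasSum (fun γ => (μ γ).toReal *
      ∫ x, cocycle ρ (densityMeasure φ) γ x ∂densityMeasure φ) (entropy μ ρ (densityMeasure φ)) ∧
    HasSum (fun γ => (μ γ).toReal *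
      ∫ x, 2 * Real.log (timeFactor (ρ γ) x) ∂densityMeasure φ)
        (entropy μ ρ (densityMeasure φ)) := by
  have := hν.1
  have hl := integrable_log_density hφ h0 hL2
  have hs := hasSum_integral_stationary hν hl
  have hJ : Summable fun γ => (μ γ).toReal *
      ∫ x, 2 * Real.log (timeFactor (ρ γ) x) ∂densityMeasure φ := by
    refine Summable.of_norm_bounded (hmom.mul_left (alpha A ρ)) fun γ => ?_
    rw [norm_mul, Real.norm_of_nonneg ENNReal.toReal_nonneg, Real.norm_eq_abs]
    have := mul_le_mul_of_nonneg_left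
      (abs_integral_log_timeFactor_le (ρ := ρ) hA γ (densityMeasure φ))
      (ENNReal.toReal_nonneg (a := μ γ))
    linarith
  have e : ∀ γ, (μ γ).toReal * ∫ x, cocycle ρ (densityMeasure φ) γ x ∂densityMeasure φ =
      (μ γ).toReal * (∫ x, Real.log (φ x) ∂densityMeasure φ) -
        (μ γ).toReal * (∫ x, Real.log (φ (ρ γ • x)) ∂densityMeasure φ) +
        (μ γ).toReal * ∫ x, 2 * Real.log (timeFactor (ρ γ) x) ∂densityMeasure φ := by
    intro γ
    by_cases hγ : γ ∈ μ.support
    · have h1 := hs.1 γ hγ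
      have h12 : Integrable (fun x => Real.log (φ x) - Real.log (φ (ρ γ • x)))
          (densityMeasure φ) := hl.sub h1
      rw [← mul_sub, ← mul_add, ← integral_sub hl h1,
        ← integral_add h12 (integrable_log_timeFactor (ρ γ) _)]
      congr 1
      refine integral_congr_ae ?_
      filter_upwards [cocycle_ae hgen hφ hν γ] with x hx
      exact hx.2.2
    · simp [(μ.apply_eq_zero_iff γ).2 hγ]
  have h2 := ((((hasSum_toReal_pmf μ).mul_right
    (∫ x, Real.log (φ x) ∂densityMeasure φ)).sub hs.2).add hJ.hasSum).congr_fun e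
  rw [one_mul, sub_self, zero_add] at h2
  have h3 : entropy μ ρ (densityMeasure φ) = _ := h2.tsum_eq
  rw [h3]
  exact ⟨h2, hJ.hasSum⟩

theorem entropy_le (hA : Subgroup.closure (A : Set Γ) = ⊤) (hgen : GeneratesAsSemigroup μ)
    (hmom : Summable fun γ => (μ γ).toReal * (wordLength A γ : ℝ)) {φ : S2 → ℝ}
    (hφ : Measurable φ) (h0 : ∀ x, 0 ≤ φ x) (hL2 : MemLp φ 2 m)
    (hν : IsStationary μ ρ (densityMeasure φ)) :
    entropy μ ρ (densityMeasure φ) ≤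
      (∑' γ, (μ γ).toReal * (wordLength A γ : ℝ)) * alpha A ρ := by
  have := hν.1
  refine hasSum_le (fun γ => ?_) (hasSum_entropy hA hgen hmom hφ h0 hL2 hν).2
    (hmom.hasSum.mul_right _)
  have := mul_le_mul_of_nonneg_left ((le_abs_self _).trans
    (abs_integral_log_timeFactor_le (ρ := ρ) hA γ (densityMeasure φ)))
    (ENNReal.toReal_nonneg (a := μ γ))
  linarith

/-! ### The lower bound for the entropy -/

theorem memLp_sqrt {φ : S2 → ℝ} (hφ : Measurable φ) (h0 : ∀ x, 0 ≤ φ x) (hL2 : MemLp φ 2 m) :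
    MemLp (fun x => √(φ x)) 2 m := by
  rw [memLp_two_iff_integrable_sq hφ.sqrt.aestronglyMeasurable]
  simp only [Real.sq_sqrt (h0 _)]
  exact hL2.integrable (by norm_num)

/-- The divergence of `ν` from `γ⁻¹_* ν` is at least the squared Hellinger distance, which is the
distance of the half-densities in `L²`. -/
theorem norm_unitaryKoopman_sub_sq_le (hgen : GeneratesAsSemigroup μ) {φ : S2 → ℝ}
    (hφ : Measurable φ) (h0 : ∀ x, 0 ≤ φ x) (hL2 : MemLp φ 2 m)
    (hν : IsStationary μ ρ (densityMeasure φ)) {ψ : H} (hψ : ψ =ᵐ[m] fun x => √(φ x))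
    (hψ1 : ‖ψ‖ = 1) {γ : Γ} (hγ : γ ∈ μ.support) :
    ‖unitaryKoopman (ρ γ) ψ - ψ‖ ^ 2 ≤
      ∫ x, cocycle ρ (densityMeasure φ) γ x ∂densityMeasure φ := by
  have := hν.1
  -- the square root of the Radon-Nikodym derivative; the bound is `-2 log F ≥ 2 - 2 F`
  let F : S2 → ℝ := fun x => √(φ (ρ γ • x)) / (timeFactor (ρ γ) x * √(φ x))
  have hU : unitaryKoopman (ρ γ) ψ =ᵐ[m] fun x => (timeFactor (ρ γ) x)⁻¹ * √(φ (ρ γ • x)) := by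
    filter_upwards [coeFn_wcomp (ρ γ) (halfDensity (ρ γ)) ψ,
      (quasiMeasurePreserving_smul (ρ γ)).ae_eq_comp hψ] with x h1 h2
    simp only [Function.comp_apply] at h2
    rw [unitaryKoopman, h1, h2]
    rfl
  have hFφ : (fun x => φ x * F x) =ᵐ[m] fun x => ψ x * unitaryKoopman (ρ γ) ψ x := by
    filter_upwards [hψ, hU] with x h1 h2
    have ht := (timeFactor_pos (ρ γ) x).ne'
    rw [h1, h2]
    rcases (h0 x).eq_or_lt with h | h
    · simp [← h]
    · have hs : √(φ x) ≠ 0 := (Real.sqrt_pos.2 h).ne'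
      simp only [F]
      nth_rewrite 1 [← Real.mul_self_sqrt h.le]
      field_simp
  have hFint : Integrable F (densityMeasure φ) := by
    rw [integrable_withDensity_ofReal_iff hφ h0]
    exact ((Lp.memLp ψ).integrable_mul (Lp.memLp (unitaryKoopman (ρ γ) ψ))).congr hFφ.symm
  have hF : ∫ x, F x ∂densityMeasure φ = inner ℝ (unitaryKoopman (ρ γ) ψ) ψ := by
    rw [integral_withDensity_ofReal hφ h0, integral_congr_ae hFφ, L2.inner_def]
    rfl
  have h1 : ∫ x, (2 - 2 * F x) ∂densityMeasure φ ≤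
      ∫ x, cocycle ρ (densityMeasure φ) γ x ∂densityMeasure φ := by
    refine integral_mono_ae ((integrable_const 2).sub (hFint.const_mul 2))
      (integrable_cocycle hgen hφ h0 hL2 hν hγ) ?_
    filter_upwards [cocycle_ae hgen hφ hν γ] with x hx
    obtain ⟨hx1, hx2, hx3⟩ := hx
    have ht := timeFactor_pos (ρ γ) x
    have hs := Real.sqrt_pos.2 hx1
    have hs' := Real.sqrt_pos.2 hx2
    have hFpos : 0 < F x := by positivity
    have h2 := Real.log_le_sub_one_of_pos hFpos
    have h3 : Real.log (F x) = Real.log (φ (ρ γ • x)) / 2 -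
        (Real.log (timeFactor (ρ γ) x) + Real.log (φ x) / 2) := by
      rw [Real.log_div hs'.ne' (by positivity), Real.log_mul ht.ne' hs.ne', Real.log_sqrt hx1.le,
        Real.log_sqrt hx2.le]
    rw [hx3]
    linarith
  rw [integral_sub (integrable_const 2) (hFint.const_mul 2), integral_const, probReal_univ,
    integral_const_mul, hF] at h1
  have h4 := (unitaryKoopman (ρ γ)).le_of_opNorm_le (norm_unitaryKoopman_le (ρ γ)) ψ
  rw [one_mul, hψ1] at h4
  rw [norm_sub_sq_real, hψ1]
  simp only [one_smul] at h1
  nlinarith [norm_nonneg (unitaryKoopman (ρ γ) ψ)]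

/-- A subadditive function which is small on the support of `p` is small on each product of elements
of the support. The constant depends only on `p` and `γ`. -/
theorem exists_le_mul_sqrt (p : Γ → ℝ) {γ : Γ} (hγ : γ ∈ Submonoid.closure {γ | 0 < p γ}) :
    ∃ C : ℝ, 0 ≤ C ∧ ∀ (d : Γ → ℝ) (h : ℝ), d 1 ≤ 0 → (∀ γ η, d (γ * η) ≤ d γ + d η) →
      (∀ γ, 0 < p γ → p γ * d γ ^ 2 ≤ h) → d γ ≤ C * √h := by
  induction hγ using Submonoid.closure_induction with
  | mem γ hγ =>
    have hγ' : 0 < p γ := hγ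
    refine ⟨(√(p γ))⁻¹, by positivity, fun d h _ _ hd => ?_⟩
    rw [← Real.sqrt_inv, ← Real.sqrt_mul (by positivity)]
    refine Real.le_sqrt_of_sq_le ?_
    rw [inv_mul_eq_div, le_div_iff₀ hγ', mul_comm]
    exact hd γ hγ'
  | one => exact ⟨0, le_rfl, fun d h h1 _ _ => by simpa using h1⟩
  | mul γ η _ _ h1 h2 =>
    obtain ⟨C, hC, h1⟩ := h1
    obtain ⟨D, hD, h2⟩ := h2
    refine ⟨C + D, by positivity, fun d h hd1 hd hp => ?_⟩
    rw [add_mul]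
    exact (hd γ η).trans (add_le_add (h1 d h hd1 hd hp) (h2 d h hd1 hd hp))

/-- A conformal factor whose logarithm reaches `α / 2` differs from `1` by a multiple of `α`
in `L²`. -/
theorem exists_le_norm_halfDensity_sub_one : ∃ c : ℝ, 0 < c ∧ ∀ (g : SO31) (α : ℝ), 0 < α → α ≤ 1 →
    (∀ x, timeFactor g x ≤ Real.exp (α / 2)) → (∀ x, (timeFactor g x)⁻¹ ≤ Real.exp (α / 2)) →
    (∃ x, Real.exp (α / 2) ≤ (timeFactor g x)⁻¹) → c * α ≤ ‖toH (halfDensity g - 1)‖ := by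
  obtain ⟨c, hc, hbd⟩ := exists_lipschitz_bound
  -- `exists_lipschitz_bound` with `l = 3 α`, `M = α / 2`, `r = 1 / 12`, and `6912 = 2 ^ 2 * 12 ^ 3`
  refine ⟨√(c / 6912), by positivity, fun g α hα hα1 h1 h2 ⟨x, hx⟩ => ?_⟩
  have hexp : Real.exp (α / 2) ≤ 1 + α := by
    have h := Real.one_sub_le_exp_neg (α / 2)
    rw [Real.exp_neg] at h
    have h3 : Real.exp (α / 2) ≤ (1 - α / 2)⁻¹ := by
      rw [le_inv_comm₀ (Real.exp_pos _) (by linarith)]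
      exact h
    refine h3.trans ?_
    rw [inv_le_iff_one_le_mul₀ (by linarith)]
    nlinarith
  have hexp2 : Real.exp (α / 2) * Real.exp (α / 2) ≤ 3 := by
    rw [← Real.exp_add, add_halves]
    exact (Real.exp_le_exp.2 hα1).trans (by linarith [Real.exp_one_lt_d9])
  have hlow : ∀ y, 1 - α / 2 ≤ timeFactor g y := fun y => by
    refine (Real.one_sub_le_exp_neg _).trans ?_
    rw [Real.exp_neg]
    exact inv_le_of_inv_le₀ (timeFactor_pos g y) (h2 y)
  have hosc : ∀ y, |timeFactor g y - timeFactor g (-y)| ≤ 2 * (3 / 4 * α) := fun y => by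
    have a1 := h1 y
    have a2 := h1 (-y)
    have a3 := hlow y
    have a4 := hlow (-y)
    rw [abs_le]
    constructor <;> linarith
  have hLip : ∀ y z, |(halfDensity g - 1) y - (halfDensity g - 1) z| ≤ 3 * α * dist y z := by
    intro y z
    have hy := timeFactor_pos g y
    have hz := timeFactor_pos g z
    have e : (halfDensity g - 1) y - (halfDensity g - 1) z =
        (timeFactor g y)⁻¹ * (timeFactor g z)⁻¹ * (timeFactor g z - timeFactor g y) := by
      simp only [ContinuousMap.sub_apply, halfDensity, ContinuousMap.coe_mk,
        ContinuousMap.one_apply]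
      field_simp
      ring
    have h3 := abs_timeFactor_sub_le hosc z y
    have h4 : (timeFactor g y)⁻¹ * (timeFactor g z)⁻¹ ≤ 3 :=
      (mul_le_mul (h2 y) (h2 z) (inv_pos.2 hz).le (Real.exp_pos _).le).trans hexp2
    rw [e, abs_mul, abs_of_pos (by positivity), dist_comm y z]
    calc _ ≤ 3 * (3 / 4 * α * dist z y) := by gcongr
      _ ≤ _ := by nlinarith [mul_nonneg hα.le (dist_nonneg (x := z) (y := y))]
  have hM : α / 2 ≤ |(halfDensity g - 1) x| := by
    refine le_trans ?_ (le_abs_self _)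
    simp only [ContinuousMap.sub_apply, halfDensity, ContinuousMap.coe_mk,
      ContinuousMap.one_apply]
    linarith [Real.add_one_le_exp (α / 2)]
  have h5 := hbd (halfDensity g - 1) (3 * α) (α / 2) (1 / 12) x (by positivity) hLip (by positivity)
    hM (by norm_num) (by norm_num) (by linarith)
  refine (sq_le_sq₀ (by positivity) (norm_nonneg _)).1 (le_trans (le_of_eq ?_) h5)
  rw [mul_pow, Real.sq_sqrt (by positivity)]
  ring

theorem summable_mul_wordLength (hexp : HasFiniteExpMoment A μ) :
    Summable fun γ => (μ γ).toReal * (wordLength A γ : ℝ) := by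
  obtain ⟨ε, hε, h⟩ := hexp
  refine Summable.of_nonneg_of_le (fun γ => by positivity) (fun γ => ?_) (h.mul_left ε⁻¹)
  have h1 := Real.add_one_le_exp (ε * wordLength A γ)
  have h2 : (wordLength A γ : ℝ) ≤ ε⁻¹ * Real.exp (ε * wordLength A γ) := by
    rw [← div_eq_inv_mul, le_div_iff₀ hε]
    linarith
  have h3 := mul_le_mul_of_nonneg_left h2 (ENNReal.toReal_nonneg (a := μ γ))
  linarith

/-- The entropy controls `α_ρ²`: it bounds how far the generators move the half-density `√φ`, which
is close to a constant by the spectral gap. -/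
theorem exists_alpha_le_sqrt_entropy (A : Finset Γ) (hA : Subgroup.closure (A : Set Γ) = ⊤)
    (B : Finset Γ) (hB : B.Nonempty) (μ : PMF Γ) (hgen : GeneratesAsSemigroup μ)
    (hmom : Summable fun γ => (μ γ).toReal * (wordLength A γ : ℝ)) (κ₀ : ℝ) (hκ₀ : 0 < κ₀) :
    ∃ D : ℝ, 0 < D ∧ ∀ ρ : Γ →* SO31, (∀ b ∈ B, ρ b ∈ K) → κ₀ ≤ repGap B ρ → 0 < alpha A ρ →
      alpha A ρ ≤ 1 → ∀ φ : S2 → ℝ, Measurable φ → (∀ x, 0 ≤ φ x) → MemLp φ 2 m →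
      IsStationary μ ρ (densityMeasure φ) →
      alpha A ρ ≤ D * √(entropy μ ρ (densityMeasure φ)) := by
  have hsupp : ∀ b : Γ, b ∈ Submonoid.closure {γ | 0 < (μ γ).toReal} := by
    intro b
    have e : {γ | 0 < (μ γ).toReal} = μ.support := by
      ext γ
      simp [ENNReal.toReal_pos_iff, pos_iff_ne_zero, μ.apply_lt_top γ]
    rw [e, show Submonoid.closure μ.support = ⊤ from hgen]
    trivial
  choose C hC0 hC using fun b => exists_le_mul_sqrt (fun γ => (μ γ).toReal) (hsupp b)
  obtain ⟨C₀, hC₀0, hC₀⟩ : ∃ C₀ : ℝ, 0 ≤ C₀ ∧ (∀ b ∈ B, C b ≤ C₀ ∧ C b⁻¹ ≤ C₀) ∧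
      ∀ a ∈ (A : Set Γ) ∪ (A : Set Γ)⁻¹, C a ≤ C₀ := by
    have hfin : ((B : Set Γ) ∪ (B : Set Γ)⁻¹ ∪ ((A : Set Γ) ∪ (A : Set Γ)⁻¹)).Finite :=
      (finite_generators B).union (finite_generators A)
    obtain ⟨M, hM⟩ := (hfin.image C).bddAbove
    have hM' : ∀ γ ∈ ((B : Set Γ) ∪ (B : Set Γ)⁻¹ ∪ ((A : Set Γ) ∪ (A : Set Γ)⁻¹)), C γ ≤ max M 0 :=
      fun γ hγ => (hM ⟨γ, hγ, rfl⟩).trans (le_max_left _ _)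
    exact ⟨max M 0, le_max_right _ _, fun b hb => ⟨hM' b (Or.inl (Or.inl hb)),
      hM' b⁻¹ (Or.inl (Or.inr (by simpa using hb)))⟩, fun a ha => hM' a (Or.inr ha)⟩
  obtain ⟨c₁, hc₁, hlow⟩ := exists_le_norm_halfDensity_sub_one
  have hcard : (0 : ℝ) < B.card := by exact_mod_cast hB.card_pos
  set C₁ : ℝ := B.card * C₀ / κ₀ with hC₁
  have hC₁0 : 0 ≤ C₁ := by positivity
  refine ⟨2 * (C₀ + 2 * C₁) / c₁ + 2 * C₁ + 1, by positivity,
    fun ρ hK hgap hα hα1 φ hφ h0 hL2 hν => ?_⟩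
  have := hν.1
  set h := entropy μ ρ (densityMeasure φ) with hh
  set ψ : H := (memLp_sqrt hφ h0 hL2).toLp _ with hψdef
  have hψ : ψ =ᵐ[m] fun x => √(φ x) := MemLp.coeFn_toLp _
  have hψ1 : ‖ψ‖ = 1 := by
    have h1 : ‖ψ‖ ^ 2 = 1 := by
      rw [← real_inner_self_eq_norm_sq, L2.inner_def]
      have e : ∫ x, inner ℝ (ψ x) (ψ x) ∂m = ∫ x, φ x * 1 ∂m := by
        refine integral_congr_ae ?_
        filter_upwards [hψ] with x hx
        rw [hx]
        simp [Real.sq_sqrt (h0 x)]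
      rw [e, ← integral_withDensity_ofReal hφ h0 (fun _ => 1)]
      simp
    nlinarith [norm_nonneg ψ]
  set d : Γ → ℝ := fun γ => ‖unitaryKoopman (ρ γ) ψ - ψ‖ with hd
  have hs := (hasSum_entropy hA hgen hmom hφ h0 hL2 hν).1
  have hk : ∀ γ, 0 < (μ γ).toReal → d γ ^ 2 ≤
      ∫ x, cocycle ρ (densityMeasure φ) γ x ∂densityMeasure φ := fun γ hγ =>
    norm_unitaryKoopman_sub_sq_le hgen hφ h0 hL2 hν hψ hψ1
      ((μ.mem_support_iff γ).2 fun h => by simp [h] at hγ)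
  have hterm : ∀ γ, 0 ≤ (μ γ).toReal *
      ∫ x, cocycle ρ (densityMeasure φ) γ x ∂densityMeasure φ := fun γ => by
    rcases (ENNReal.toReal_nonneg (a := μ γ)).eq_or_lt with h | h
    · rw [← h, zero_mul]
    · exact mul_nonneg h.le ((sq_nonneg _).trans (hk γ h))
  have hdC : ∀ γ, d γ ≤ C γ * √h := fun γ => by
    refine hC γ d h ?_ (fun γ η => ?_) fun γ hγ => ?_
    · simp [hd, unitaryKoopman_one]
    · have e : unitaryKoopman (ρ (γ * η)) ψ - ψ = unitaryKoopman (ρ η)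
          (unitaryKoopman (ρ γ) ψ - ψ) + (unitaryKoopman (ρ η) ψ - ψ) := by
        rw [map_mul, unitaryKoopman_mul, mul_apply_eq_comp, map_sub]
        abel
      simp only [hd]
      rw [e]
      refine (norm_add_le _ _).trans (add_le_add_left ?_ _)
      simpa using (unitaryKoopman (ρ η)).le_of_opNorm_le (norm_unitaryKoopman_le (ρ η))
        (unitaryKoopman (ρ γ) ψ - ψ)
    · exact (mul_le_mul_of_nonneg_left (hk γ hγ) hγ.le).trans
        (le_hasSum hs γ fun η _ => hterm η)
  have hh0 : 0 ≤ √h := Real.sqrt_nonneg h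
  -- by the spectral gap, the half-density is almost constant
  set c : ℝ := inner ℝ (toH 1) ψ with hc
  set f : H := ψ - c • toH 1 with hf
  have hf1 : inner ℝ (toH 1) f = 0 := by
    rw [hf, inner_sub_right, inner_smul_right, real_inner_self_eq_norm_sq, norm_one_H, hc]
    ring
  have hfnorm : ‖f‖ ^ 2 = 1 - c ^ 2 := by
    rw [hf, norm_sub_sq_real, norm_smul, norm_one_H, inner_smul_right, real_inner_comm, mul_one,
      Real.norm_eq_abs, sq_abs, hψ1, ← hc]
    ring
  have hVf : ∀ g : SO31, (∀ x, timeFactor g x = 1) →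
      koopman g f - f = unitaryKoopman g ψ - ψ := fun g hg => by
    rw [unitaryKoopman_eq_koopman hg, hf, map_sub, map_smul, koopman_toH_one]
    abel
  have hfle : ‖f‖ ≤ C₁ * √h := by
    have h1 := norm_sum_koopman_le_repGap B hB ρ hK hκ₀.le hgap f hf1
    have e : (2 * (B.card : ℝ)) • f = ∑ b ∈ B, (koopman (ρ b) f + koopman (ρ b)⁻¹ f) -
        ∑ b ∈ B, ((koopman (ρ b) f - f) + (koopman (ρ b)⁻¹ f - f)) := by
      rw [← Finset.sum_sub_distrib]
      have : ∀ b ∈ B, koopman (ρ b) f + koopman (ρ b)⁻¹ f -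
          ((koopman (ρ b) f - f) + (koopman (ρ b)⁻¹ f - f)) = (2 : ℝ) • f := fun b _ => by
        rw [two_smul]; abel
      rw [Finset.sum_congr rfl this, Finset.sum_const, ← Nat.cast_smul_eq_nsmul ℝ, smul_smul,
        mul_comm]
    have h2 : ‖∑ b ∈ B, ((koopman (ρ b) f - f) + (koopman (ρ b)⁻¹ f - f))‖
        ≤ B.card * (2 * (C₀ * √h)) := by
      refine (norm_sum_le_of_le B (fun b hb => ?_ : ∀ b ∈ B, _ ≤ 2 * (C₀ * √h))).trans ?_
      · refine (norm_add_le _ _).trans ?_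
        rw [hVf _ (timeFactor_eq_one_of_mem_K (hK b hb)),
          hVf _ (timeFactor_inv_eq_one_of_mem_K (hK b hb)), ← map_inv]
        have h3 := (hdC b).trans (mul_le_mul_of_nonneg_right (hC₀.1 b hb).1 hh0)
        have h4 := (hdC b⁻¹).trans (mul_le_mul_of_nonneg_right (hC₀.1 b hb).2 hh0)
        simp only [hd] at h3 h4
        linarith
      · rw [Finset.sum_const, nsmul_eq_mul]
    have h3 : 2 * B.card * ‖f‖ ≤ (2 * B.card - 2 * κ₀) * ‖f‖ + B.card * (2 * (C₀ * √h)) := by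
      have : ‖(2 * (B.card : ℝ)) • f‖ = 2 * B.card * ‖f‖ := by
        rw [norm_smul, Real.norm_of_nonneg (by positivity)]
      rw [← this, e]
      exact (norm_sub_le _ _).trans (add_le_add h1 h2)
    rw [hC₁, div_mul_eq_mul_div, le_div_iff₀ hκ₀]
    linarith
  rcases le_or_gt (C₁ * √h) (1 / 2) with hcase | hcase
  · -- the constant is bounded below, and a generator moves the constants by a multiple of `α_ρ`
    have hcabs : 1 / 2 ≤ |c| := by
      have h1 : ‖f‖ ^ 2 ≤ (1 / 2) ^ 2 := pow_le_pow_left₀ (norm_nonneg _) (hfle.trans hcase) 2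
      rw [hfnorm] at h1
      refine abs_le_of_sq_le_sq' (a := 1 / 2) ?_ (abs_nonneg c) |>.2
      rw [sq_abs]
      linarith
    obtain ⟨a, ha, hax⟩ := exists_generator_alpha A ρ hα
    have h1 := hlow (ρ a) (alpha A ρ) hα hα1 (timeFactor_generator_le A ρ ha)
      (inv_timeFactor_generator_le A ρ ha) hax
    have e1 : toH (halfDensity (ρ a) - 1) = unitaryKoopman (ρ a) (toH 1) - toH 1 := by
      rw [unitaryKoopman, wcomp_toH, map_sub]
      congr 2
      ext x
      simp
    have e2 : c • (unitaryKoopman (ρ a) (toH 1) - toH 1) =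
        (unitaryKoopman (ρ a) ψ - ψ) - (unitaryKoopman (ρ a) f - f) := by
      rw [hf, map_sub, map_smul, smul_sub]
      abel
    have h2 : |c| * ‖unitaryKoopman (ρ a) (toH 1) - toH 1‖ ≤ (C₀ + 2 * C₁) * √h := by
      rw [← Real.norm_eq_abs, ← norm_smul, e2]
      have h3 := (hdC a).trans (mul_le_mul_of_nonneg_right (hC₀.2 a ha) hh0)
      have h4 := (unitaryKoopman (ρ a)).le_of_opNorm_le (norm_unitaryKoopman_le (ρ a)) f
      have h5 := norm_sub_le (unitaryKoopman (ρ a) f) f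
      have h6 := norm_sub_le (unitaryKoopman (ρ a) ψ - ψ) (unitaryKoopman (ρ a) f - f)
      simp only [hd] at h3
      linarith
    have h3 : c₁ * alpha A ρ ≤ 2 * (C₀ + 2 * C₁) * √h := by
      rw [e1] at h1
      have := mul_le_mul_of_nonneg_right hcabs
        (norm_nonneg (unitaryKoopman (ρ a) (toH 1) - toH 1))
      linarith
    have h4 : alpha A ρ ≤ 2 * (C₀ + 2 * C₁) / c₁ * √h := by
      rw [div_mul_eq_mul_div, le_div_iff₀ hc₁]
      linarith
    have h5 : 0 ≤ (2 * C₁ + 1) * √h := by positivity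
    linarith
  · -- the entropy is bounded below, and `α_ρ ≤ 1`
    have h5 : 0 ≤ (2 * (C₀ + 2 * C₁) / c₁ + 1) * √h := by positivity
    linarith

end Entropy

end SpectralGapEntropy

end

theorem theorem5p1 {Γ : Type*} [Group Γ] (A : Finset Γ)
    (hA : Subgroup.closure (A : Set Γ) = ⊤) (B : Finset Γ) (hB : B.Nonempty)
    (μ : PMF Γ) (hgen : SpectralGapEntropy.GeneratesAsSemigroup μ)
    (hexp : SpectralGapEntropy.HasFiniteExpMoment A μ)
    (κ₀ : ℝ) (hκ₀ : 0 < κ₀) :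
    ∃ c L α₀ : ℝ, 0 < c ∧ 0 < L ∧ 0 < α₀ ∧
      ∀ ρ : Γ →* SpectralGapEntropy.SO31,
        SpectralGapEntropy.ZariskiDense ρ →
        (∀ b ∈ B, ρ b ∈ SpectralGapEntropy.K) →
        κ₀ ≤ SpectralGapEntropy.repGap B ρ →
        0 < SpectralGapEntropy.alpha A ρ →
        SpectralGapEntropy.alpha A ρ ≤ α₀ →
        ∃ ν : MeasureTheory.Measure SpectralGapEntropy.S2,
          SpectralGapEntropy.IsStationary μ ρ ν ∧
          (∀ ν' : MeasureTheory.Measure SpectralGapEntropy.S2,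
            SpectralGapEntropy.IsStationary μ ρ ν' → ν' = ν) ∧
          SpectralGapEntropy.EntropyIntegrable μ ρ ν ∧
          c * SpectralGapEntropy.alpha A ρ ^ 2 ≤ SpectralGapEntropy.entropy μ ρ ν ∧
          SpectralGapEntropy.entropy μ ρ ν ≤ L * SpectralGapEntropy.alpha A ρ := by
  classical
  obtain ⟨n, q, σ, α₁, hq0, hq1, hσ, hσq, hα₁, hcon⟩ :=
    SpectralGapEntropy.exists_contraction A hA B hB μ hgen hexp κ₀ hκ₀
  have hmom := SpectralGapEntropy.summable_mul_wordLength hexp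
  obtain ⟨D, hD, hlow⟩ :=
    SpectralGapEntropy.exists_alpha_le_sqrt_entropy A hA B hB μ hgen hmom κ₀ hκ₀
  have hS : 0 ≤ ∑' γ, (μ γ).toReal * (SpectralGapEntropy.wordLength A γ : ℝ) :=
    tsum_nonneg fun γ => by positivity
  refine ⟨(D ^ 2)⁻¹, (∑' γ, (μ γ).toReal * (SpectralGapEntropy.wordLength A γ : ℝ)) + 1,
    min α₁ 1, by positivity, by positivity, lt_min hα₁ one_pos, fun ρ _ hK hgap hα hαle => ?_⟩
  obtain ⟨hmk, hQ, hQC⟩ := hcon ρ hK hgap hα.le (hαle.trans (min_le_left _ _))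
  obtain ⟨φ, hφ, h0, hL2, hν⟩ :=
    SpectralGapEntropy.exists_stationary_density hB hq0 hq1 hmk hQ
  refine ⟨SpectralGapEntropy.densityMeasure φ, hν, fun ν' hν' =>
    SpectralGapEntropy.stationary_unique hB hq0 hσ hσq hmk hQ hQC hν hν',
    SpectralGapEntropy.entropyIntegrable hA hgen hmom hφ h0 hL2 hν, ?_, ?_⟩
  · have h1 := hlow ρ hK hgap hα (hαle.trans (min_le_right _ _)) φ hφ h0 hL2 hν
    -- a negative entropy would have square root zero, against `0 < α_ρ`
    have h2 : 0 ≤ SpectralGapEntropy.entropy μ ρ (SpectralGapEntropy.densityMeasure φ) := by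
      by_contra hneg
      rw [Real.sqrt_eq_zero_of_nonpos (not_le.1 hneg).le, mul_zero] at h1
      linarith
    have h3 := pow_le_pow_left₀ hα.le h1 2
    rw [mul_pow, Real.sq_sqrt h2] at h3
    rwa [inv_mul_le_iff₀ (by positivity)]
  · have h1 := SpectralGapEntropy.entropy_le hA hgen hmom hφ h0 hL2 hν
    linarith
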